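/- Let $(X_t)_{t\ge 0}$ be a (jointly measurable, temporally homogeneous) Markov process on $\mathbb R^d$ with transition semigroup $(P_t)_{t\ge 0}$ and invariant probability measure $\mu$. For $p>0$ and probability measures $\nu_0,\nu_1$ on $\mathbb R^d$ let $$\mathcal T_p(\nu_0,\nu_1):=\inf_{\pi}\int_{\mathbb R^d\times\mathbb R^d}|x-y|^p\,\pi(\mathrm dx,\mathrm dy),\qquad \mathbb W_p(\nu_0,\nu_1):=\big[\mathcal T_p(\nu_0,\nu_1)\big]^{1\wedge\frac1p},$$ where the infimum runs over all couplings $\pi$ of $\nu_0$ and $\nu_1$. For $T>0$ let $\mu_T:=\frac1T\int_0^T\delta_{X_t}\,\mathrm dt$ be the empirical measure, and let $\mathbb E^\mu$ denote the expectation for the process with initial law $\mu$. Assume the exponential contractivity (H1): there exist constants $C_0\ge 1$ and $\lambda_{\mathrm E}>0$ such that for every probability measure $\nu$ on $\mathbb R^d$ and every $t\ge 0$, $$\mathbb W_1(\nu P_t,\mu P_t)\le C_0\,\mathrm e^{-\lambda_{\mathrm E}t}\,\mathbb W_1(\nu,\mu).$$ Let $p>0$, and assume that $\int_{\mathbb R^d}|x|^q\,\mu(\mathrm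 dx)<\infty$ for some $q>\max\{p,1\}$. Put $$\zeta:=\max\Big\{\frac{q}{q-p},\ \frac dp\Big\}.$$ Then there exists a constant $C>0$ such that for all $T\ge 2$, $$\mathbb E^\mu\big[\mathcal T_p(\mu_T,\mu)\big]\le C\,T^{-\frac{p}{2\zeta p+1}}\,L_1(T)\,L_2(T),$$ where $L_1(T)=(\log T)^{\frac{2d}{2d+1}}$ if $p\ne d$ and $q=\frac{dp}{d-p}$, and $L_1(T)=1$ otherwise; and $L_2(T)=(\log T)^{\frac{2q}{2q+(q/d)-1}}$ if $p=d$, and $L_2(T)=1$ otherwise. -/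

import Mathlib

open MeasureTheory ProbabilityTheory
open scoped NNReal ENNReal

noncomputable section

namespace EmpiricalMarkov

/-- The state space `ℝ^d` with its Euclidean norm. -/
abbrev Space (d : ℕ) : Type := EuclideanSpace ℝ (Fin d)

variable {d : ℕ}

/-- `π` is a coupling of `ν₀` and `ν₁`: its marginals are `ν₀` and `ν₁`. -/
def IsCoupling (π : Measure (Space d × Space d)) (ν₀ ν₁ : Measure (Space d)) : Prop :=
  π.map Prod.fst = ν₀ ∧ π.map Prod.snd = ν₁

/-- The optimal transport cost `𝒯_p(ν₀, ν₁) = inf_π ∫ |x - y|^p π(dx, dy) ∈ [0, ∞]`, the infimum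
being taken over all couplings `π` of `ν₀` and `ν₁`. -/
def transportCost (p : ℝ) (ν₀ ν₁ : Measure (Space d)) : ℝ≥0∞ :=
  ⨅ (π : Measure (Space d × Space d)) (_ : IsCoupling π ν₀ ν₁),
    ∫⁻ z, ‖z.1 - z.2‖ₑ ^ p ∂π

/-- The Wasserstein distance `W_p = 𝒯_p ^ (1 ∧ 1/p) ∈ [0, ∞]`. -/
def wasserstein (p : ℝ) (ν₀ ν₁ : Measure (Space d)) : ℝ≥0∞ :=
  transportCost p ν₀ ν₁ ^ min 1 (1 / p)

/-- A (jointly measurable, temporally homogeneous) Markov process `((X_t)_{t ≥ 0}, (ℙ^x)_x)` on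
`ℝ^d`, the Markov property being taken with respect to the filtration generated by `X`. -/
structure MarkovProcess (d : ℕ) (Ω : Type*) [MeasurableSpace Ω] where
  /-- The paths: `X t ω` is the position at time `t`. -/
  X : ℝ≥0 → Ω → Space d
  /-- `law x` is the probability `ℙ^x` for the starting point `x`; it depends measurably on `x`. -/
  law : Kernel (Space d) Ω
  isMarkovKernel_law : IsMarkovKernel law
  measurable_X : Measurable fun z : ℝ≥0 × Ω => X z.1 z.2
  /-- `ℙ^x (X_0 = x) = 1`. -/
  start : ∀ x : Space d, ∀ᵐ ω ∂(law x), X 0 ω = x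
  /-- `ℙ^x (X_{s+t} ∈ A | σ(X_u, u ≤ s)) = ℙ^{X_s} (X_t ∈ A)`, written out as the defining
  property of the conditional probability. -/
  markov : ∀ (x : Space d) (s t : ℝ≥0) (A : Set (Space d)) (B : Set Ω), MeasurableSet A →
    MeasurableSet[⨆ u : Set.Iic s, MeasurableSpace.comap (X u) inferInstance] B →
      law x (B ∩ X (s + t) ⁻¹' A) = ∫⁻ ω in B, law (X s ω) (X t ⁻¹' A) ∂(law x)

namespace MarkovProcess

variable {Ω : Type*} [MeasurableSpace Ω]

/-- The transition kernel `P_t(x, A) = ℙ^x (X_t ∈ A)`, i.e. `P_t f(x) = 𝔼^x [f(X_t)]`. -/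
def transition (M : MarkovProcess d Ω) (t : ℝ≥0) : Kernel (Space d) (Space d) :=
  M.law.map (M.X t)

/-- The measure `ℙ^ν = ∫ ℙ^x ν(dx)` of the process with initial law `ν`. -/
def lawFrom (M : MarkovProcess d Ω) (ν : Measure (Space d)) : Measure Ω :=
  ν.bind M.law

/-- `μ` is an invariant probability measure: `μ P_t = μ` for all `t ≥ 0`. -/
def IsInvariant (M : MarkovProcess d Ω) (μ : Measure (Space d)) : Prop :=
  IsProbabilityMeasure μ ∧ ∀ t : ℝ≥0, Kernel.Invariant (M.transition t) μ

/-- Exponential contractivity in the `1`-Wasserstein distance: there are `C ≥ 1` and `lam > 0` with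
`W_1(ν P_t, μ P_t) ≤ C e^{-lam t} W_1(ν, μ)` for all probability measures `ν` and all `t ≥ 0`. -/
def IsExpContractive (M : MarkovProcess d Ω) (μ : Measure (Space d)) : Prop :=
  ∃ C lam : ℝ, 1 ≤ C ∧ 0 < lam ∧
    ∀ ν : Measure (Space d), IsProbabilityMeasure ν → ∀ t : ℝ≥0,
      wasserstein 1 (ν.bind (M.transition t)) (μ.bind (M.transition t)) ≤
        ENNReal.ofReal (C * Real.exp (-lam * t)) * wasserstein 1 ν μ

/-- The empirical measure `μ_T = (1/T) ∫_0^T δ_{X_t} dt`, that is, the image of the uniform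
distribution on `[0, T]` under the path `t ↦ X_t(ω)`. -/
def empiricalMeasure (M : MarkovProcess d Ω) (T : ℝ) (ω : Ω) : Measure (Space d) :=
  (ENNReal.ofReal T)⁻¹ •
    (volume.restrict (Set.Icc (0 : ℝ) T)).map fun t : ℝ => M.X t.toNNReal ω

end MarkovProcess

/-- `ζ(p, q, d) = max {q / (q - p), d / p}`. -/
def zeta (p q : ℝ) (d : ℕ) : ℝ := max (q / (q - p)) (d / p)

end EmpiricalMarkov

end

/-! The cost is bounded by comparing masses on dyadic cells. Space is cut into shells of radius
about `2^n`, and each shell into cubes of side `2^(n-l)`. Matching as much mass as possible in the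
finest cells, then the leftovers in coarser and coarser ones, bounds the transport cost by the sum
over `l` and `n` of `2^((n-l)p)` times the total discrepancy of the two measures over the cells of
level `l` in shell `n`, plus a term for the finest mesh (`transportCost_le_meanDiscrepancy`).

Contractivity in `W_1` controls Lipschitz observables only, and cell indicators are not Lipschitz.
One random parameter `v`, uniform on `[0, 1]`, therefore dilates the shells and translates the
grids. The probability `cellKernel` that two points share a cell is then Lipschitz in each point,
with constant of order `2^(l-n)` (`cellKernel_le_add`). The averaged sum of squared deviations is a
quadratic expression in this kernel (`meanSquare_add`). By stationarity and exponential
decorrelation its expectation is at most of order `T⁻¹ 2^l 2^(-nq)`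
(`exists_lintegral_meanSquare_le`).

Cauchy–Schwarz over the roughly `2^(ld)` cells of a shell bounds the squared expected discrepancy by
`T⁻¹ 2^(l(d+1)) 2^(-nq)`, while the tail of `μ` bounds the expected discrepancy by `2^(-nq)`.
Interpolation gives `T^(-θ) 2^(lθ(d+1)) 2^(-nq(1-θ))` whenever `0 ≤ 2θ ≤ 1`. The double series
converges if `p < q(1-θ)` and `θ(d+1) < p`. The exponent `p / (2ζp + 1)` satisfies both strictly
(`rate_bounds`), so no logarithm arises; the logarithmic factors of the statement are bounded below
for `T ≥ 2` and only affect the constant. -/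

noncomputable section

namespace EmpiricalMarkov

/-! ### Greedy matching of two measures along nested partitions. -/

section Matching

variable {E ι : Type*} [MeasurableSpace E] [MeasurableSpace ι] [MeasurableSingletonClass ι]

lemma sum_smul_restrict_fiber_apply (α : Measure E) {c : E → ι} (hc : Measurable c)
    (r : ι → ℝ≥0∞) (i : ι) :
    Measure.sum (fun j => r j • α.restrict (c ⁻¹' {j})) (c ⁻¹' {i}) = r i * α (c ⁻¹' {i}) := by
  have hm : ∀ i, MeasurableSet (c ⁻¹' {i}) := fun i => hc (measurableSet_singleton i)
  rw [Measure.sum_apply _ (hm i), tsum_eq_single i]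
  · simp
  · intro j hj
    have : c ⁻¹' {i} ∩ c ⁻¹' {j} = ∅ := by
      ext x
      simp only [Set.mem_inter_iff, Set.mem_preimage, Set.mem_singleton_iff, Set.mem_empty_iff_false,
        iff_false, not_and]
      rintro rfl h
      exact hj h.symm
    simp [Measure.restrict_apply (hm i), this]

/-- If the mass `π` is matched along a map `c`, then the remainders `α'`, `β'` differ on the fibres
of `c` by as much as `α` and `β` do. -/
lemma tsub_eq_of_matched {α β α' β' : Measure E} {π : Measure (E × E)} [IsFiniteMeasure α]
    {c : E → ι} (hc : Measurable c) (hα : α = π.map Prod.fst + α') (hβ : β = π.map Prod.snd + β')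
    (hπ : ∀ᵐ z ∂π, c z.1 = c z.2) (i : ι) :
    α' (c ⁻¹' {i}) - β' (c ⁻¹' {i}) = α (c ⁻¹' {i}) - β (c ⁻¹' {i}) ∧
      β' (c ⁻¹' {i}) - α' (c ⁻¹' {i}) = β (c ⁻¹' {i}) - α (c ⁻¹' {i}) := by
  have hm := hc (measurableSet_singleton i)
  have h1 : π.map Prod.fst (c ⁻¹' {i}) = π.map Prod.snd (c ⁻¹' {i}) := by
    rw [Measure.map_apply measurable_fst hm, Measure.map_apply measurable_snd hm]
    refine measure_congr ?_
    filter_upwards [hπ] with z hz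
    apply propext
    change c z.1 = i ↔ c z.2 = i
    rw [hz]
  have hfin : π.map Prod.fst (c ⁻¹' {i}) ≠ ∞ := by
    refine ne_top_of_le_ne_top (measure_ne_top α (c ⁻¹' {i})) ?_
    conv_rhs => rw [hα]
    exact le_self_add
  conv => rhs; rw [hα, hβ]
  rw [hα, hβ]
  simp only [Measure.add_apply, ← h1]
  exact ⟨(ENNReal.add_sub_add_eq_sub_left hfin).symm,
    (ENNReal.add_sub_add_eq_sub_left hfin).symm⟩

variable [Countable ι]

lemma measurableSet_eq_fun_countable {F : Type*} [MeasurableSpace F] {f g : F → ι}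
    (hf : Measurable f) (hg : Measurable g) : MeasurableSet {z | f z = g z} := by
  have : {z | f z = g z} = ⋃ i, f ⁻¹' {i} ∩ g ⁻¹' {i} := by
    ext z; simp [eq_comm]
  rw [this]
  exact .iUnion fun i => (hf (measurableSet_singleton i)).inter (hg (measurableSet_singleton i))

lemma sum_restrict_fiber (α : Measure E) {c : E → ι} (hc : Measurable c) :
    Measure.sum (fun i => α.restrict (c ⁻¹' {i})) = α := by
  rw [← Measure.restrict_iUnion]
  · have : (⋃ i, c ⁻¹' {i}) = Set.univ := by ext x; simp
    rw [this, Measure.restrict_univ]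
  · intro i j hij
    exact Disjoint.preimage _ (by simpa using hij)
  · exact fun i => hc (measurableSet_singleton i)

lemma inv_max_mul_le_one (a b : ℝ≥0∞) : (max a b)⁻¹ * b ≤ 1 := by
  calc (max a b)⁻¹ * b ≤ (max a b)⁻¹ * max a b := by gcongr; exact le_max_right a b
    _ ≤ 1 := ENNReal.inv_mul_le_one _

lemma one_sub_inv_max_mul {a b : ℝ≥0∞} (ha : a ≠ ∞) (hb : b ≠ ∞) :
    (1 - (max a b)⁻¹ * b) * a = a - b := by
  rcases le_total a b with h | h
  · rw [max_eq_right h, tsub_eq_zero_of_le h]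
    rcases eq_or_ne b 0 with rfl | hb0
    · simp [le_antisymm h (zero_le)]
    · rw [ENNReal.inv_mul_cancel hb0 hb, tsub_self, zero_mul]
  · rw [max_eq_left h]
    rcases eq_or_ne a 0 with rfl | ha0
    · simp
    · rw [ENNReal.sub_mul (fun _ _ => ha), one_mul, mul_right_comm, ENNReal.inv_mul_cancel ha0 ha,
        one_mul]

/-- Within each fibre of `c`, as much mass as possible of two finite measures is matched. -/
lemma exists_matching (α β : Measure E) [IsFiniteMeasure α] [IsFiniteMeasure β]
    {c : E → ι} (hc : Measurable c) :
    ∃ (π : Measure (E × E)) (α' β' : Measure E), α = π.map Prod.fst + α' ∧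
      β = π.map Prod.snd + β' ∧ (∀ᵐ z ∂π, c z.1 = c z.2) ∧
      (∀ i, α' (c ⁻¹' {i}) = α (c ⁻¹' {i}) - β (c ⁻¹' {i})) ∧
      (∀ i, β' (c ⁻¹' {i}) = β (c ⁻¹' {i}) - α (c ⁻¹' {i})) := by
  have hm : ∀ i, MeasurableSet (c ⁻¹' {i}) := fun i => hc (measurableSet_singleton i)
  set a : ι → ℝ≥0∞ := fun i => α (c ⁻¹' {i})
  set b : ι → ℝ≥0∞ := fun i => β (c ⁻¹' {i})
  have hdec : ∀ (γ : Measure E) (r : ι → ℝ≥0∞), (∀ i, r i ≤ 1) →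
      γ = Measure.sum (fun i => r i • γ.restrict (c ⁻¹' {i})) +
        Measure.sum (fun i => (1 - r i) • γ.restrict (c ⁻¹' {i})) := by
    intro γ r hr
    rw [Measure.sum_add_sum]
    conv_lhs => rw [← sum_restrict_fiber γ hc]
    congr 1
    ext1 i
    rw [← add_smul, add_tsub_cancel_of_le (hr i), one_smul]
  -- On a fibre with masses `a` and `b`, the product measure divided by `max a b` has mass `a * b /
  -- max a b = min a b`, which is the most that can be matched there.
  refine ⟨Measure.sum fun i =>
      (max (a i) (b i))⁻¹ • (α.restrict (c ⁻¹' {i})).prod (β.restrict (c ⁻¹' {i})),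
    Measure.sum fun i => (1 - (max (a i) (b i))⁻¹ * b i) • α.restrict (c ⁻¹' {i}),
    Measure.sum fun i => (1 - (max (b i) (a i))⁻¹ * a i) • β.restrict (c ⁻¹' {i}), ?_, ?_, ?_, ?_, ?_⟩
  · rw [Measure.map_sum measurable_fst.aemeasurable]
    convert hdec α (fun i => (max (a i) (b i))⁻¹ * b i) (fun i => inv_max_mul_le_one _ _) using 3
    ext1 i
    rw [Measure.map_smul, Measure.map_fst_prod, smul_smul, Measure.restrict_apply_univ]
  · rw [Measure.map_sum measurable_snd.aemeasurable]
    convert hdec β (fun i => (max (b i) (a i))⁻¹ * a i) (fun i => inv_max_mul_le_one _ _) using 3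
    ext1 i
    rw [Measure.map_smul, Measure.map_snd_prod, smul_smul, Measure.restrict_apply_univ, max_comm]
  · have hset : MeasurableSet {z : E × E | c z.1 = c z.2} :=
      measurableSet_eq_fun_countable (hc.comp measurable_fst) (hc.comp measurable_snd)
    rw [Measure.ae_sum_iff' hset]
    intro i
    refine Measure.ae_smul_measure ?_ _
    rw [Measure.prod_restrict]
    refine (ae_restrict_mem ((hm i).prod (hm i))).mono ?_
    rintro z ⟨h1, h2⟩
    exact Eq.trans h1 (Eq.symm h2)
  · intro i
    rw [sum_smul_restrict_fiber_apply α hc]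
    exact one_sub_inv_max_mul (measure_ne_top _ _) (measure_ne_top _ _)
  · intro i
    rw [sum_smul_restrict_fiber_apply β hc]
    exact one_sub_inv_max_mul (measure_ne_top _ _) (measure_ne_top _ _)

lemma lintegral_comp_countable (α : Measure E) {c : E → ι} (hc : Measurable c) (W : ι → ℝ≥0∞) :
    ∫⁻ x, W (c x) ∂α = ∑' i, W i * α (c ⁻¹' {i}) := by
  rw [← lintegral_map (μ := α) (f := W) (measurable_of_countable W) hc, lintegral_countable']
  congr 1
  ext1 i
  rw [Measure.map_apply hc (measurableSet_singleton i)]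

/-- Greedy matching along a nested sequence of countable partitions, from the finest (level `L`)
to the coarsest (level `0`). -/
lemma exists_multilevel_matching (cost : E × E → ℝ≥0∞) (W : ι → ℝ≥0∞) (w : E → ℝ≥0∞) (L : ℕ) :
    ∀ (c : ℕ → E → ι) (g : ℕ → ι → ι) (δ : ℕ → ℝ≥0∞) (α β : Measure E) [IsFiniteMeasure α]
      [IsFiniteMeasure β], (∀ l, Measurable (c l)) → (∀ l x, c l x = g l (c (l + 1) x)) →
      (∀ l x, W (c l x) = w x) →
      (∀ l x y, c l x = c l y → cost (x, y) ≤ δ l * w x) →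
      ∃ (π : Measure (E × E)) (α' β' : Measure E), α = π.map Prod.fst + α' ∧
        β = π.map Prod.snd + β' ∧ (∀ᵐ z ∂π, c 0 z.1 = c 0 z.2) ∧
        (∀ i, α' (c 0 ⁻¹' {i}) = α (c 0 ⁻¹' {i}) - β (c 0 ⁻¹' {i})) ∧
        (∀ i, β' (c 0 ⁻¹' {i}) = β (c 0 ⁻¹' {i}) - α (c 0 ⁻¹' {i})) ∧
        ∫⁻ z, cost z ∂π ≤ δ L * ∫⁻ x, w x ∂α + ∑ l ∈ Finset.range L, δ l *
          ∑' j, W j * (α (c (l + 1) ⁻¹' {j}) - β (c (l + 1) ⁻¹' {j})) := by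
  have step : ∀ (c : E → ι) (δ : ℝ≥0∞) (α α' : Measure E) (π : Measure (E × E)), Measurable c →
      (∀ x, W (c x) = w x) → (∀ x y, c x = c y → cost (x, y) ≤ δ * w x) →
      α = π.map Prod.fst + α' → (∀ᵐ z ∂π, c z.1 = c z.2) →
      ∫⁻ z, cost z ∂π ≤ δ * ∫⁻ x, w x ∂α := by
    intro c δ α α' π hc hW hcost hα hπ
    have hw : Measurable w := by
      have : w = fun x => W (c x) := funext fun x => (hW x).symm
      rw [this]; exact (measurable_of_countable W).comp hc
    calc ∫⁻ z, cost z ∂π ≤ ∫⁻ z, δ * w z.1 ∂π := by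
          refine lintegral_mono_ae ?_
          filter_upwards [hπ] with z hz using hcost _ _ hz
      _ = δ * ∫⁻ x, w x ∂(π.map Prod.fst) := by
          rw [lintegral_const_mul δ (f := fun z : E × E => w z.1) (hw.comp measurable_fst),
            lintegral_map hw measurable_fst]
      _ ≤ δ * ∫⁻ x, w x ∂α := by
          gcongr
          rw [hα]; exact Measure.le_add_right le_rfl
  induction L with
  | zero =>
    intro c g δ α β _ _ hc hg hW hcost
    obtain ⟨π, α', β', h1, h2, h3, h4, h5⟩ := exists_matching α β (hc 0)
    refine ⟨π, α', β', h1, h2, h3, h4, h5, ?_⟩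
    simpa using step (c 0) (δ 0) α α' π (hc 0) (hW 0) (hcost 0) h1 h3
  | succ L ih =>
    intro c g δ α β _ _ hc hg hW hcost
    -- The finer levels are matched first: the induction hypothesis is applied to the sequence of
    -- partitions without its coarsest member.
    obtain ⟨π, α', β', h1, h2, h3, h4, h5, h6⟩ := ih (fun l => c (l + 1)) (fun l => g (l + 1))
      (fun l => δ (l + 1)) α β (fun l => hc _) (fun l => hg _) (fun l => hW _) (fun l => hcost _)
    have hα' : IsFiniteMeasure α' := by
      refine isFiniteMeasure_of_le α ?_
      conv_rhs => rw [h1]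
      exact Measure.le_add_left le_rfl
    have hβ' : IsFiniteMeasure β' := by
      refine isFiniteMeasure_of_le β ?_
      conv_rhs => rw [h2]
      exact Measure.le_add_left le_rfl
    obtain ⟨π₀, α'', β'', k1, k2, k3, k4, k5⟩ := exists_matching α' β' (hc 0)
    have h3' : ∀ᵐ z ∂π, c 0 z.1 = c 0 z.2 := by
      filter_upwards [h3] with z hz
      rw [hg 0, hg 0, hz]
    refine ⟨π + π₀, α'', β'', ?_, ?_, ?_, ?_, ?_, ?_⟩
    · rw [Measure.map_add _ _ measurable_fst, add_assoc, ← k1, ← h1]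
    · rw [Measure.map_add _ _ measurable_snd, add_assoc, ← k2, ← h2]
    · rw [ae_add_measure_iff]
      exact ⟨h3', k3⟩
    · intro i
      rw [k4, (tsub_eq_of_matched (hc 0) h1 h2 h3' i).1]
    · intro i
      rw [k5, (tsub_eq_of_matched (hc 0) h1 h2 h3' i).2]
    · rw [lintegral_add_measure, Finset.sum_range_succ', ← add_assoc]
      -- What is left of `α` in a cell of level 1 is exactly its excess over `β` there, and moving
      -- it inside a cell of level 0 costs at most `δ 0` per unit of weight.
      refine add_le_add h6 ((step (c 0) (δ 0) α' α'' π₀ (hc 0) (hW 0) (hcost 0) k1 k3).trans ?_)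
      gcongr
      simp_rw [← hW 1]
      rw [lintegral_comp_countable α' (hc 1) W]
      simp only [zero_add] at h4 ⊢
      simp_rw [h4]
      exact le_rfl

/-- Multiscale upper bound for the cost of transporting `α` to `β`. -/
lemma exists_coupling_le_multilevel (cost : E × E → ℝ≥0∞) (W : ι → ℝ≥0∞) (w : E → ℝ≥0∞) (L : ℕ)
    (c : ℕ → E → ι) (g : ℕ → ι → ι) (δ : ℕ → ℝ≥0∞) (K : ℝ≥0∞) (α β : Measure E)
    [IsProbabilityMeasure α] [IsProbabilityMeasure β] (hc : ∀ l, Measurable (c l))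
    (hg : ∀ l x, c l x = g l (c (l + 1) x)) (hW : ∀ l x, W (c l x) = w x)
    (hcost : ∀ l x y, c l x = c l y → cost (x, y) ≤ δ l * w x)
    (hcost' : ∀ x y, cost (x, y) ≤ K * (w x + w y)) :
    ∃ π : Measure (E × E), π.map Prod.fst = α ∧ π.map Prod.snd = β ∧
      ∫⁻ z, cost z ∂π ≤ δ L * ∫⁻ x, w x ∂α + ∑ l ∈ Finset.range L, δ l *
          ∑' j, W j * (α (c (l + 1) ⁻¹' {j}) - β (c (l + 1) ⁻¹' {j})) +
        K * ∑' j, W j * ((α (c 0 ⁻¹' {j}) - β (c 0 ⁻¹' {j})) +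
          (β (c 0 ⁻¹' {j}) - α (c 0 ⁻¹' {j}))) := by
  obtain ⟨π, α', β', h1, h2, h3, h4, h5, h6⟩ :=
    exists_multilevel_matching cost W w L c g δ α β hc hg hW hcost
  have hα' : IsFiniteMeasure α' := by
    refine isFiniteMeasure_of_le α ?_
    conv_rhs => rw [h1]
    exact Measure.le_add_left le_rfl
  have hβ' : IsFiniteMeasure β' := by
    refine isFiniteMeasure_of_le β ?_
    conv_rhs => rw [h2]
    exact Measure.le_add_left le_rfl
  have hw : Measurable w := by
    have : w = fun x => W (c 0 x) := funext fun x => (hW 0 x).symm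
    rw [this]; exact (measurable_of_countable W).comp (hc 0)
  have hπ1 : π.map Prod.fst Set.univ = π Set.univ := by
    rw [Measure.map_apply measurable_fst .univ, Set.preimage_univ]
  have hπ2 : π.map Prod.snd Set.univ = π Set.univ := by
    rw [Measure.map_apply measurable_snd .univ, Set.preimage_univ]
  have hmass : α' Set.univ = β' Set.univ := by
    have e1 : π Set.univ + α' Set.univ = 1 := by
      rw [← hπ1, ← Measure.add_apply, ← h1, measure_univ]
    have e2 : π Set.univ + β' Set.univ = 1 := by
      rw [← hπ2, ← Measure.add_apply, ← h2, measure_univ]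
    have hfin : π Set.univ ≠ ∞ := ne_top_of_le_ne_top ENNReal.one_ne_top (e1 ▸ le_self_add)
    exact (ENNReal.add_right_inj hfin).1 (e1.trans e2.symm)
  set m := α' Set.univ with hm
  have hmtop : m ≠ ∞ := measure_ne_top _ _
  -- If nothing is left over, `m⁻¹ * m` is `0` and not `1`, but then `γ` vanishes as well.
  have hcancel : ∀ γ : Measure E, γ Set.univ = m → (m⁻¹ * m) • γ = γ := by
    intro γ hγ
    rcases eq_or_ne m 0 with h0 | h0
    · rw [h0, Measure.measure_univ_eq_zero] at hγ
      rw [hγ, smul_zero]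
    · rw [ENNReal.inv_mul_cancel h0 hmtop, one_smul]
  have hf : (m⁻¹ • α'.prod β').map Prod.fst = α' := by
    rw [Measure.map_smul, Measure.map_fst_prod, smul_smul, ← hmass, hcancel α' rfl]
  have hs : (m⁻¹ • α'.prod β').map Prod.snd = β' := by
    rw [Measure.map_smul, Measure.map_snd_prod, smul_smul, hcancel β' hmass.symm]
  refine ⟨π + m⁻¹ • α'.prod β', ?_, ?_, ?_⟩
  · rw [Measure.map_add _ _ measurable_fst, hf, ← h1]
  · rw [Measure.map_add _ _ measurable_snd, hs, ← h2]
  · rw [lintegral_add_measure]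
    refine add_le_add h6 ?_
    calc ∫⁻ z, cost z ∂(m⁻¹ • α'.prod β')
        ≤ ∫⁻ z, K * (w z.1 + w z.2) ∂(m⁻¹ • α'.prod β') := lintegral_mono fun z => hcost' _ _
      _ = K * (∫⁻ x, w x ∂α' + ∫⁻ x, w x ∂β') := by
          rw [lintegral_const_mul K (f := fun z : E × E => w z.1 + w z.2)
              ((hw.comp measurable_fst).add (hw.comp measurable_snd)),
            lintegral_add_left (f := fun z : E × E => w z.1) (hw.comp measurable_fst)]
          rw [← lintegral_map hw measurable_fst, ← lintegral_map hw measurable_snd, hf, hs]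
      _ = _ := by
          simp_rw [← hW 0]
          rw [lintegral_comp_countable α' (hc 0) W, lintegral_comp_countable β' (hc 0) W,
            ← ENNReal.tsum_add]
          simp_rw [h4, h5, mul_add]

end Matching

/-! ### Cauchy–Schwarz and randomly shifted grids on the line. -/

lemma sq_lintegral_le_lintegral_sq {F : Type*} [MeasurableSpace F] {P : Measure F}
    [IsProbabilityMeasure P] {f : F → ℝ≥0∞} (hf : AEMeasurable f P) :
    (∫⁻ x, f x ∂P) ^ 2 ≤ ∫⁻ x, f x ^ 2 ∂P := by
  have h := ENNReal.lintegral_mul_le_Lp_mul_Lq P Real.HolderConjugate.two_two hf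
    (aemeasurable_const (b := (1 : ℝ≥0∞)))
  simp only [Pi.mul_apply, mul_one, ENNReal.one_rpow, lintegral_const, measure_univ,
    ENNReal.rpow_two, one_pow] at h
  calc (∫⁻ x, f x ∂P) ^ 2 ≤ ((∫⁻ x, f x ^ 2 ∂P) ^ (1 / 2 : ℝ)) ^ 2 := by gcongr
    _ = ∫⁻ x, f x ^ 2 ∂P := by
        rw [← ENNReal.rpow_two, ← ENNReal.rpow_mul]
        norm_num

/-- Since `N` is an integer, the fractional part of `N * v` has period 1 in `v`, so its mean over a
unit interval is unaffected by a shift. The two fractional parts cancel on average and only the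
linear part remains. -/
lemma integral_floor_mul_add_sub (N : ℕ) (a b : ℝ) :
    IntervalIntegrable (fun v : ℝ => (⌊N * (b + v)⌋ : ℝ) - ⌊N * (a + v)⌋) volume 0 1 ∧
      ∫ v in (0 : ℝ)..1, ((⌊N * (b + v)⌋ : ℝ) - ⌊N * (a + v)⌋) = N * (b - a) := by
  have hint : ∀ c : ℝ, IntervalIntegrable (fun v : ℝ => Int.fract (N * (c + v))) volume 0 1 := by
    intro c
    refine (intervalIntegrable_const (c := (1 : ℝ))).mono_fun
      (measurable_fract.comp (by fun_prop)).aestronglyMeasurable (.of_forall fun v => ?_)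
    dsimp only
    rw [Real.norm_of_nonneg (Int.fract_nonneg _), norm_one]
    exact (Int.fract_lt_one _).le
  have hper : Function.Periodic (fun v : ℝ => Int.fract (N * v)) 1 := by
    intro v
    change Int.fract (N * (v + 1)) = Int.fract (N * v)
    rw [mul_add, mul_one, Int.fract_add_natCast]
  have hval : ∀ c : ℝ, ∫ v in (0 : ℝ)..1, Int.fract (N * (c + v)) =
      ∫ v in (0 : ℝ)..1, Int.fract (N * v) := by
    intro c
    rw [intervalIntegral.integral_comp_add_left (fun v : ℝ => Int.fract (N * v)) c, add_zero]
    have := hper.intervalIntegral_add_eq c 0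
    rwa [zero_add] at this
  have heq : (fun v : ℝ => (⌊N * (b + v)⌋ : ℝ) - ⌊N * (a + v)⌋) =
      fun v => N * (b - a) - (Int.fract (N * (b + v)) - Int.fract (N * (a + v))) := by
    ext v
    simp only [Int.fract]
    ring
  rw [heq]
  refine ⟨intervalIntegrable_const.sub ((hint b).sub (hint a)), ?_⟩
  rw [intervalIntegral.integral_sub intervalIntegrable_const ((hint b).sub (hint a)),
    intervalIntegral.integral_sub (hint b) (hint a), hval, hval]
  simp

/-- Two reals are separated by a uniformly shifted grid of mesh `1 / N` with probability at most
`N` times their distance. -/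
lemma volume_floor_mul_add_ne_le (N : ℕ) (a b : ℝ) :
    volume {v : ℝ | v ∈ Set.Icc 0 1 ∧ ⌊N * (a + v)⌋ ≠ ⌊N * (b + v)⌋} ≤
      ENNReal.ofReal (N * |a - b|) := by
  wlog hab : a ≤ b generalizing a b
  · have h := this b a (le_of_not_ge hab)
    simpa only [ne_comm, abs_sub_comm] using h
  obtain ⟨hi, hv⟩ := integral_floor_mul_add_sub N a b
  have hmono : ∀ v : ℝ, ⌊N * (a + v)⌋ ≤ ⌊N * (b + v)⌋ := fun v => by gcongr
  have hmeas : MeasurableSet {v : ℝ | v ∈ Set.Icc 0 1 ∧ ⌊N * (a + v)⌋ ≠ ⌊N * (b + v)⌋} := by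
    refine measurableSet_Icc.inter (MeasurableSet.compl ?_)
    exact measurableSet_eq_fun (Int.measurable_floor.comp (by fun_prop))
      (Int.measurable_floor.comp (by fun_prop))
  rw [← lintegral_indicator_one hmeas]
  calc ∫⁻ v, {v : ℝ | v ∈ Set.Icc 0 1 ∧ ⌊N * (a + v)⌋ ≠ ⌊N * (b + v)⌋}.indicator 1 v
      ≤ ∫⁻ v, (Set.Icc (0 : ℝ) 1).indicator
          (fun v => ENNReal.ofReal ((⌊N * (b + v)⌋ : ℝ) - ⌊N * (a + v)⌋)) v := by
        refine lintegral_mono fun v => ?_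
        by_cases hv : v ∈ {v : ℝ | v ∈ Set.Icc 0 1 ∧ ⌊N * (a + v)⌋ ≠ ⌊N * (b + v)⌋}
        · rw [Set.indicator_of_mem hv, Set.indicator_of_mem hv.1, Pi.one_apply,
            ← ENNReal.ofReal_one]
          apply ENNReal.ofReal_le_ofReal
          have h1 := lt_of_le_of_ne (hmono v) hv.2
          have : (⌊N * (a + v)⌋ : ℝ) + 1 ≤ ⌊N * (b + v)⌋ := by exact_mod_cast h1
          linarith
        · rw [Set.indicator_of_notMem hv]
          exact zero_le
    _ = ENNReal.ofReal (N * |a - b|) := by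
        rw [lintegral_indicator measurableSet_Icc, Measure.restrict_congr_set Ioc_ae_eq_Icc.symm,
          ← ofReal_integral_eq_lintegral_ofReal
            ((intervalIntegrable_iff_integrableOn_Ioc_of_le zero_le_one).1 hi)
            (.of_forall fun v => ?_),
          ← intervalIntegral.integral_of_le zero_le_one, hv, abs_sub_comm,
          abs_of_nonneg (by linarith)]
        have := hmono v
        simpa using this

/-! ### Randomly dilated shells and shifted dyadic cubes. -/

section Cells

variable {d : ℕ}

/-- The dyadic shell `{(1 + v) 2^(n-1) ≤ ‖x‖ < (1 + v) 2^n}` containing `x`; the shell `0` is a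
ball. -/
@[irreducible] def shell (v : ℝ) (x : Space d) : ℕ := Nat.size ⌊‖x‖ / (1 + v)⌋₊

/-- The shell of `x` together with the dyadic cube of side `2^(n-l)`, in a grid shifted in
proportion to `v`, that contains `x`. -/
def cell (l : ℕ) (v : ℝ) (x : Space d) : ℕ × (Fin d → ℤ) :=
  (shell v x, fun i => ⌊((2 ^ l : ℕ) : ℝ) * (x i / 2 ^ shell v x + v)⌋)

/-- A region containing the `n`-th shell for every `v ∈ [0, 1]`. -/
def outer (d n : ℕ) : Set (Space d) := {x | (2 : ℝ) ^ n ≤ 2 * (1 + ‖x‖)}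

lemma shell_le_iff {v : ℝ} (hv : 0 ≤ v) (x : Space d) (n : ℕ) :
    shell v x ≤ n ↔ ‖x‖ < (1 + v) * 2 ^ n := by
  rw [shell, Nat.size_le, Nat.floor_lt (by positivity), div_lt_iff₀' (by positivity)]
  norm_cast

lemma norm_lt_of_shell {v : ℝ} (hv : v ∈ Set.Icc (0 : ℝ) 1) (x : Space d) :
    ‖x‖ < 2 * 2 ^ shell v x := by
  have h := (shell_le_iff hv.1 x (shell v x)).1 le_rfl
  refine h.trans_le ?_
  gcongr
  linarith [hv.2]

lemma mem_outer_shell {v : ℝ} (hv : 0 ≤ v) (x : Space d) : x ∈ outer d (shell v x) := by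
  change (2 : ℝ) ^ shell v x ≤ 2 * (1 + ‖x‖)
  rcases h : shell v x with _ | m
  · have := norm_nonneg x
    rw [pow_zero]; linarith
  · have h1 : ¬ shell v x ≤ m := by omega
    rw [shell_le_iff hv, not_lt] at h1
    have : (2 : ℝ) ^ m ≤ (1 + v) * 2 ^ m := le_mul_of_one_le_left (by positivity) (by linarith)
    rw [pow_succ]; linarith

lemma measurable_shell : Measurable fun z : ℝ × Space d => shell z.1 z.2 := by
  unfold shell
  exact (measurable_of_countable Nat.size).comp (Nat.measurable_floor.comp (by fun_prop))

lemma measurable_cell (l : ℕ) : Measurable fun z : ℝ × Space d => cell l z.1 z.2 := by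
  refine measurable_shell.prodMk (measurable_pi_iff.2 fun i => ?_)
  have h : Measurable fun z : ℝ × Space d => (2 : ℝ) ^ shell z.1 z.2 :=
    (measurable_of_countable fun n : ℕ => (2 : ℝ) ^ n).comp measurable_shell
  have h2 : Measurable fun z : ℝ × Space d => z.2 i := by fun_prop
  have h3 : Measurable fun z : ℝ × Space d =>
      ((2 ^ l : ℕ) : ℝ) * (z.2 i / 2 ^ shell z.1 z.2 + z.1) :=
    ((h2.div h).add measurable_fst).const_mul _
  exact h3.floor

lemma measurable_cell_left (l : ℕ) (v : ℝ) : Measurable (cell (d := d) l v) :=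
  Measurable.comp (f := Prod.mk v) (g := fun z : ℝ × Space d => cell l z.1 z.2)
    (measurable_cell l) measurable_prodMk_left

/-- The shell does not depend on the level, and `⌊t⌋` is the integer quotient of `⌊2t⌋` by 2, also
for negative `t`. Hence the partitions are nested for each fixed `v`. -/
lemma cell_eq_parent (l : ℕ) (v : ℝ) (x : Space d) :
    cell l v x = ((cell (l + 1) v x).1, fun i => (cell (l + 1) v x).2 i / 2) := by
  refine Prod.ext rfl (funext fun i => ?_)
  change ⌊((2 ^ l : ℕ) : ℝ) * (x i / 2 ^ shell v x + v)⌋ =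
    ⌊((2 ^ (l + 1) : ℕ) : ℝ) * (x i / 2 ^ shell v x + v)⌋ / 2
  set y := x i / 2 ^ shell v x + v
  have h : ((2 ^ (l + 1) : ℕ) : ℝ) * y = 2 * (((2 ^ l : ℕ) : ℝ) * y) := by push_cast; ring
  rw [h]
  set t := ((2 ^ l : ℕ) : ℝ) * y
  have h1 := Int.floor_le (2 * t)
  have h2 := Int.lt_floor_add_one (2 * t)
  rw [Int.floor_eq_iff]
  set m := ⌊2 * t⌋
  have h3 : 2 * (m / 2) ≤ m := by omega
  have h4 : m + 1 ≤ 2 * (m / 2) + 2 := by omega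
  have h3' : (2 : ℝ) * ((m / 2 : ℤ) : ℝ) ≤ m := by exact_mod_cast h3
  have h4' : (m : ℝ) + 1 ≤ 2 * ((m / 2 : ℤ) : ℝ) + 2 := by exact_mod_cast h4
  constructor <;> linarith

lemma abs_sub_apply_le_norm (y z : Space d) (i : Fin d) : |y i - z i| ≤ ‖y - z‖ := by
  simpa using PiLp.norm_apply_le (y - z) i

lemma norm_sub_le_of_cell_eq {l : ℕ} {v : ℝ} {x y : Space d} (h : cell l v x = cell l v y) :
    ‖x - y‖ ≤ d * 2 ^ shell v x / 2 ^ l := by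
  have hs : shell v y = shell v x := (congrArg Prod.fst h).symm
  have hi : ∀ i, |x i - y i| ≤ 2 ^ shell v x / 2 ^ l := by
    intro i
    have h1 : ⌊((2 ^ l : ℕ) : ℝ) * (x i / 2 ^ shell v x + v)⌋ =
        ⌊((2 ^ l : ℕ) : ℝ) * (y i / 2 ^ shell v x + v)⌋ := by
      have := congrFun (congrArg Prod.snd h) i
      simpa only [cell, hs] using this
    have h2 := (Int.abs_sub_lt_one_of_floor_eq_floor h1).le
    have h3 : ((2 ^ l : ℕ) : ℝ) * (x i / 2 ^ shell v x + v) -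
        ((2 ^ l : ℕ) : ℝ) * (y i / 2 ^ shell v x + v) =
        (2 ^ l / 2 ^ shell v x) * (x i - y i) := by push_cast; ring
    rw [h3, abs_mul, abs_of_pos (by positivity), div_mul_eq_mul_div, div_le_one (by positivity)]
      at h2
    rw [le_div_iff₀ (by positivity)]
    linarith
  set r : ℝ := 2 ^ shell v x / 2 ^ l with hr
  have hr0 : 0 ≤ r := by positivity
  rw [mul_div_assoc, ← hr, EuclideanSpace.norm_eq]
  refine Real.sqrt_le_iff.2 ⟨by positivity, ?_⟩
  calc ∑ i, ‖(x - y) i‖ ^ 2 ≤ ∑ _i : Fin d, r ^ 2 := by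
        refine Finset.sum_le_sum fun i _ => ?_
        have := hi i
        simp only [PiLp.sub_apply, Real.norm_eq_abs]
        gcongr
    _ = d * r ^ 2 := by simp
    _ ≤ (d * r) ^ 2 := by
        rw [mul_pow]
        gcongr
        exact_mod_cast Nat.le_self_pow two_ne_zero d

/-- The sphere of radius `(1 + v) 2^m` passes between the two points only for `v` in an interval of
length `(‖z‖ - ‖y‖) / 2^m`. -/
lemma volume_shell_separated_le (m : ℕ) (y z : Space d) :
    volume {v : ℝ | 0 ≤ v ∧ shell v y ≤ m ∧ ¬ shell v z ≤ m} ≤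
      ENNReal.ofReal (‖y - z‖ / 2 ^ m) := by
  calc _ ≤ volume (Set.Icc (‖y‖ / 2 ^ m - 1) (‖z‖ / 2 ^ m - 1)) := by
        refine measure_mono fun v ⟨hv, h1, h2⟩ => ?_
        rw [shell_le_iff hv] at h1 h2
        rw [not_lt] at h2
        rw [Set.mem_Icc, sub_le_iff_le_add, le_sub_iff_add_le, div_le_iff₀ (by positivity),
          le_div_iff₀ (by positivity), add_comm v 1]
        exact ⟨h1.le, h2⟩
    _ ≤ _ := by
        rw [Real.volume_Icc]
        apply ENNReal.ofReal_le_ofReal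
        rw [sub_sub_sub_cancel_right, ← sub_div]
        gcongr
        rw [norm_sub_rev]
        exact norm_sub_norm_le z y

/-- For a random `v`, two points are rarely in different cells. -/
lemma volume_cell_separated_le (l n : ℕ) (y z : Space d) :
    volume {v : ℝ | v ∈ Set.Icc 0 1 ∧ shell v y = n ∧ cell l v y ≠ cell l v z} ≤
      ENNReal.ofReal ((d + 3) * 2 ^ l / 2 ^ n) * ‖y - z‖ₑ := by
  -- Two points are separated by the outer sphere of the shell, by its inner sphere, or by a
  -- hyperplane in one of `d` directions. These contribute `1`, `2` and `d * 2^l` to the Lipschitz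
  -- constant. The innermost shell has no inner sphere, whence `0 < n`.
  have hsub : {v : ℝ | v ∈ Set.Icc 0 1 ∧ shell v y = n ∧ cell l v y ≠ cell l v z} ⊆
      ({v : ℝ | 0 ≤ v ∧ shell v y ≤ n ∧ ¬ shell v z ≤ n} ∪
        {v : ℝ | 0 ≤ v ∧ 0 < n ∧ shell v z ≤ n - 1 ∧ ¬ shell v y ≤ n - 1}) ∪
      ⋃ i, {v : ℝ | v ∈ Set.Icc 0 1 ∧ ⌊((2 ^ l : ℕ) : ℝ) * (y i / 2 ^ n + v)⌋ ≠
        ⌊((2 ^ l : ℕ) : ℝ) * (z i / 2 ^ n + v)⌋} := by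
    rintro v ⟨hv, hn, hne⟩
    by_cases hz : shell v z = n
    · right
      by_contra hcon
      apply hne
      refine Prod.ext (hn.trans hz.symm) (funext fun i => ?_)
      simp only [Set.mem_iUnion, Set.mem_ofPred_eq, not_exists, not_and, not_not] at hcon
      simp only [cell, hn, hz]
      exact hcon i hv
    · left
      rcases lt_or_gt_of_ne hz with h | h
      · right; refine ⟨hv.1, ?_, ?_, ?_⟩ <;> omega
      · left; refine ⟨hv.1, ?_, ?_⟩ <;> omega
  have h2l : (1 : ℝ) ≤ 2 ^ l := one_le_pow₀ one_le_two
  have hA := volume_shell_separated_le n y z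
  have hB : volume {v : ℝ | 0 ≤ v ∧ 0 < n ∧ shell v z ≤ n - 1 ∧ ¬ shell v y ≤ n - 1} ≤
      ENNReal.ofReal (2 * (‖y - z‖ / 2 ^ n)) := by
    rcases n with _ | m
    · simp
    · refine (measure_mono ?_).trans ((volume_shell_separated_le m z y).trans (le_of_eq ?_))
      · rintro v ⟨h1, -, h2, h3⟩
        exact ⟨h1, h2, h3⟩
      · rw [norm_sub_rev, pow_succ]
        congr 1
        field_simp
  have hC : ∀ i, volume {v : ℝ | v ∈ Set.Icc 0 1 ∧ ⌊((2 ^ l : ℕ) : ℝ) * (y i / 2 ^ n + v)⌋ ≠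
        ⌊((2 ^ l : ℕ) : ℝ) * (z i / 2 ^ n + v)⌋} ≤
      ENNReal.ofReal (2 ^ l * (‖y - z‖ / 2 ^ n)) := by
    intro i
    refine (volume_floor_mul_add_ne_le _ _ _).trans (ENNReal.ofReal_le_ofReal ?_)
    push_cast
    rw [← sub_div, abs_div, abs_of_pos (a := (2 : ℝ) ^ n) (by positivity)]
    gcongr
    exact abs_sub_apply_le_norm y z i
  have hr : 0 ≤ ‖y - z‖ / 2 ^ n := by positivity
  calc _ ≤ _ := measure_mono hsub
    _ ≤ (ENNReal.ofReal (‖y - z‖ / 2 ^ n) + ENNReal.ofReal (2 * (‖y - z‖ / 2 ^ n))) +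
        ∑ _i : Fin d, ENNReal.ofReal (2 ^ l * (‖y - z‖ / 2 ^ n)) := by
        refine (measure_union_le _ _).trans (add_le_add ?_ ?_)
        · exact (measure_union_le _ _).trans (add_le_add hA hB)
        · exact (measure_iUnion_fintype_le _ _).trans (Finset.sum_le_sum fun i _ => hC i)
    _ = ENNReal.ofReal ((‖y - z‖ / 2 ^ n + 2 * (‖y - z‖ / 2 ^ n)) +
          d * (2 ^ l * (‖y - z‖ / 2 ^ n))) := by
        rw [Finset.sum_const, Finset.card_univ, Fintype.card_fin, nsmul_eq_mul,
          ENNReal.ofReal_add (by positivity) (by positivity),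
          ENNReal.ofReal_add (by positivity) (by positivity),
          ENNReal.ofReal_mul (p := (d : ℝ)) (by positivity), ENNReal.ofReal_natCast]
    _ ≤ ENNReal.ofReal (((d + 3) * 2 ^ l / 2 ^ n) * ‖y - z‖) := by
        apply ENNReal.ofReal_le_ofReal
        have : ((d + 3) * 2 ^ l / 2 ^ n) * ‖y - z‖ =
          (d * 2 ^ l + 3 * 2 ^ l) * (‖y - z‖ / 2 ^ n) := by ring
        rw [this]
        nlinarith
    _ = _ := by
        rw [ENNReal.ofReal_mul (by positivity), ofReal_norm]

end Cells

/-- `|a - b|` in `[0, ∞]`. -/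
def absDiff (a b : ℝ≥0∞) : ℝ≥0∞ := (a - b) + (b - a)

lemma absDiff_le_add (a b : ℝ≥0∞) : absDiff a b ≤ a + b :=
  add_le_add tsub_le_self tsub_le_self

lemma absDiff_sq_add {a b : ℝ≥0∞} (ha : a ≠ ∞) (hb : b ≠ ∞) :
    absDiff a b ^ 2 + 2 * (a * b) = a * a + b * b := by
  wlog hab : a ≤ b generalizing a b
  · have h := this hb ha (le_of_not_ge hab)
    rw [absDiff, add_comm (b - a), mul_comm b a, add_comm (b * b)] at h
    exact h
  · obtain ⟨c, rfl⟩ := exists_add_of_le hab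
    rw [absDiff, tsub_eq_zero_of_le hab, zero_add, ENNReal.add_sub_cancel_left ha]
    ring

/-! ### Multiscale bound for the transport cost, and the averaged cell kernel. -/

section Multiscale

variable {d : ℕ}

/-- The transport scale `|·|^p` at distances of order `2^n`. -/
def weight (p : ℝ) (n : ℕ) : ℝ≥0∞ := ((2 : ℝ≥0∞) ^ n) ^ p

/-- The relative transport scale of the cells of level `l`. -/
def mesh (d : ℕ) (p : ℝ) (l : ℕ) : ℝ≥0∞ := ((d : ℝ≥0∞) * (2 ^ l)⁻¹) ^ p

/-- The total variation between `α` and `β` over the cells of level `l` in the shell `n`. -/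
def discrepancy (α β : Measure (Space d)) (l n : ℕ) (v : ℝ) : ℝ≥0∞ :=
  ∑' k : Fin d → ℤ, absDiff (α (cell l v ⁻¹' {(n, k)})) (β (cell l v ⁻¹' {(n, k)}))

/-- The average of `discrepancy` over the random shift. -/
def meanDiscrepancy (α β : Measure (Space d)) (l n : ℕ) : ℝ≥0∞ :=
  ∫⁻ v in Set.Icc (0 : ℝ) 1, discrepancy α β l n v

instance isProbabilityMeasure_restrict_Icc :
    IsProbabilityMeasure (volume.restrict (Set.Icc (0 : ℝ) 1)) :=
  ⟨by simp⟩

lemma measurable_measure_cell (α : Measure (Space d)) [SFinite α] (l : ℕ)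
    (j : ℕ × (Fin d → ℤ)) : Measurable fun v : ℝ => α (cell l v ⁻¹' {j}) :=
  measurable_measure_prodMk_left (s := (fun z : ℝ × Space d => cell l z.1 z.2) ⁻¹' {j})
    (measurable_cell l (measurableSet_singleton j))

lemma measurable_absDiff_cell (α β : Measure (Space d)) [SFinite α] [SFinite β] (l : ℕ)
    (j : ℕ × (Fin d → ℤ)) :
    Measurable fun v : ℝ => absDiff (α (cell l v ⁻¹' {j})) (β (cell l v ⁻¹' {j})) :=
  ((measurable_measure_cell α l j).sub (measurable_measure_cell β l j)).add
    ((measurable_measure_cell β l j).sub (measurable_measure_cell α l j))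

lemma measurable_discrepancy (α β : Measure (Space d)) [SFinite α] [SFinite β] (l n : ℕ) :
    Measurable (discrepancy α β l n) :=
  .tsum fun k => measurable_absDiff_cell α β l (n, k)

lemma tsum_weight_mul_absDiff (α β : Measure (Space d)) (p : ℝ) (l : ℕ) (v : ℝ) :
    ∑' j : ℕ × (Fin d → ℤ),
        weight p j.1 * absDiff (α (cell l v ⁻¹' {j})) (β (cell l v ⁻¹' {j})) =
      ∑' n, weight p n * discrepancy α β l n v := by
  rw [ENNReal.tsum_prod']
  refine tsum_congr fun n => ?_
  rw [discrepancy, ← ENNReal.tsum_mul_left]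

lemma lintegral_tsum_weight_mul_discrepancy (α β : Measure (Space d)) [SFinite α] [SFinite β]
    (p : ℝ) (l : ℕ) :
    ∫⁻ v in Set.Icc (0 : ℝ) 1, ∑' n, weight p n * discrepancy α β l n v =
      ∑' n, weight p n * meanDiscrepancy α β l n := by
  rw [lintegral_tsum fun n => ((measurable_discrepancy α β l n).const_mul _).aemeasurable]
  exact tsum_congr fun n => lintegral_const_mul _ (measurable_discrepancy α β l n)

lemma weight_shell_le {p : ℝ} (hp : 0 ≤ p) {v : ℝ} (hv : 0 ≤ v) (x : Space d) :
    weight p (shell v x) ≤ (2 * (1 + ‖x‖ₑ)) ^ p := by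
  refine ENNReal.rpow_le_rpow ?_ hp
  have h := ENNReal.ofReal_le_ofReal (mem_outer_shell hv x)
  rwa [ENNReal.ofReal_pow (by norm_num), ENNReal.ofReal_mul (by norm_num),
    ENNReal.ofReal_add (by norm_num) (norm_nonneg _), ofReal_norm, ENNReal.ofReal_one,
    ENNReal.ofReal_ofNat] at h

lemma enorm_sub_rpow_le_of_cell_eq {p : ℝ} (hp : 0 ≤ p) {l : ℕ} {v : ℝ} {x y : Space d}
    (h : cell l v x = cell l v y) :
    ‖x - y‖ₑ ^ p ≤ mesh d p l * weight p (shell v x) := by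
  rw [mesh, weight, ← ENNReal.mul_rpow_of_nonneg _ _ hp]
  refine ENNReal.rpow_le_rpow ?_ hp
  rw [← ofReal_norm]
  refine (ENNReal.ofReal_le_ofReal (norm_sub_le_of_cell_eq h)).trans (le_of_eq ?_)
  rw [mul_div_right_comm, ENNReal.ofReal_mul (by positivity), ENNReal.ofReal_pow (by norm_num),
    div_eq_mul_inv, ENNReal.ofReal_mul (by positivity), ENNReal.ofReal_inv_of_pos (by positivity),
    ENNReal.ofReal_pow (by norm_num), ENNReal.ofReal_natCast, ENNReal.ofReal_ofNat]

lemma enorm_sub_rpow_le_weight {p : ℝ} (hp : 0 ≤ p) {v : ℝ} (hv : v ∈ Set.Icc (0 : ℝ) 1)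
    (x y : Space d) :
    ‖x - y‖ₑ ^ p ≤ 4 ^ p * (weight p (shell v x) + weight p (shell v y)) := by
  have hle : ∀ x : Space d, ‖x‖ₑ ≤ 2 * 2 ^ shell v x := by
    intro x
    rw [← ofReal_norm]
    refine (ENNReal.ofReal_le_ofReal (norm_lt_of_shell hv x).le).trans (le_of_eq ?_)
    rw [ENNReal.ofReal_mul (by norm_num), ENNReal.ofReal_pow (by norm_num), ENNReal.ofReal_ofNat]
  -- Comparing both radii with the larger one avoids convexity, so that `p < 1` is covered too.
  have key : ∀ m n : ℕ, m ≤ n → ((2 : ℝ≥0∞) * 2 ^ m + 2 * 2 ^ n) ^ p ≤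
      4 ^ p * (weight p m + weight p n) := by
    intro m n hmn
    calc ((2 : ℝ≥0∞) * 2 ^ m + 2 * 2 ^ n) ^ p ≤ (2 * 2 ^ n + 2 * 2 ^ n) ^ p := by
          gcongr
          exact one_le_two
      _ = 4 ^ p * weight p n := by
          rw [weight, ← ENNReal.mul_rpow_of_nonneg _ _ hp]
          congr 1
          ring
      _ ≤ _ := by gcongr; exact le_add_self
  refine (ENNReal.rpow_le_rpow (enorm_sub_le.trans (add_le_add (hle x) (hle y))) hp).trans ?_
  rcases le_total (shell v x) (shell v y) with h | h
  · exact key _ _ h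
  · rw [add_comm, add_comm (weight p _)]
    exact key _ _ h

lemma transportCost_le_of_shift {p : ℝ} (hp : 0 ≤ p) (α β : Measure (Space d))
    [IsProbabilityMeasure α] [IsProbabilityMeasure β] (L : ℕ) {v : ℝ}
    (hv : v ∈ Set.Icc (0 : ℝ) 1) :
    transportCost p α β ≤ mesh d p L * ∫⁻ x, (2 * (1 + ‖x‖ₑ)) ^ p ∂α +
      ∑ l ∈ Finset.range L, mesh d p l * ∑' n, weight p n * discrepancy α β (l + 1) n v +
      4 ^ p * ∑' n, weight p n * discrepancy α β 0 n v := by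
  obtain ⟨π, h1, h2, h3⟩ := exists_coupling_le_multilevel
    (fun z : Space d × Space d => ‖z.1 - z.2‖ₑ ^ p) (fun j : ℕ × (Fin d → ℤ) => weight p j.1)
    (fun x => weight p (shell v x)) L (fun l => cell l v)
    (fun _ j => (j.1, fun i => j.2 i / 2)) (mesh d p) (4 ^ p) α β
    (fun l => measurable_cell_left l v) (fun l x => cell_eq_parent l v x) (fun _ _ => rfl)
    (fun l x y h => enorm_sub_rpow_le_of_cell_eq hp h)
    (fun x y => enorm_sub_rpow_le_weight hp hv x y)
  refine (iInf₂_le_of_le π ⟨h1, h2⟩ le_rfl).trans (h3.trans ?_)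
  refine add_le_add (add_le_add ?_ ?_) (le_of_eq ?_)
  · gcongr with x
    exact weight_shell_le hp hv.1 x
  · refine Finset.sum_le_sum fun l _ => ?_
    rw [← tsum_weight_mul_absDiff]
    gcongr
    exact le_self_add
  · rw [← tsum_weight_mul_absDiff]
    rfl

/-- Multiscale bound for the transport cost by discrepancies over randomly shifted dyadic cells. -/
lemma transportCost_le_meanDiscrepancy {p : ℝ} (hp : 0 ≤ p) (α β : Measure (Space d))
    [IsProbabilityMeasure α] [IsProbabilityMeasure β] (L : ℕ) :
    transportCost p α β ≤ mesh d p L * ∫⁻ x, (2 * (1 + ‖x‖ₑ)) ^ p ∂α +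
      ∑ l ∈ Finset.range L, mesh d p l * ∑' n, weight p n * meanDiscrepancy α β (l + 1) n +
      4 ^ p * ∑' n, weight p n * meanDiscrepancy α β 0 n := by
  have hm : ∀ l, Measurable fun v => ∑' n, weight p n * discrepancy α β l n v := fun l =>
    .tsum fun n => (measurable_discrepancy α β l n).const_mul _
  -- The transport cost does not depend on the shift, so the bounds for the individual `v` may be
  -- averaged.
  calc transportCost p α β = ∫⁻ _v in Set.Icc (0 : ℝ) 1, transportCost p α β := by
        rw [lintegral_const, measure_univ, mul_one]
    _ ≤ _ := setLIntegral_mono' measurableSet_Icc fun v hv => transportCost_le_of_shift hp α β L hv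
    _ = _ := by
        rw [lintegral_add_right _ ((hm 0).const_mul _), lintegral_add_left measurable_const,
          lintegral_const, measure_univ, mul_one, lintegral_const_mul _ (hm 0),
          lintegral_finsetSum _ fun l _ => (hm (l + 1)).const_mul _]
        simp_rw [lintegral_const_mul _ (hm _), lintegral_tsum_weight_mul_discrepancy]

lemma tsum_measure_cell_le (α : Measure (Space d)) (l n : ℕ) {v : ℝ} (hv : 0 ≤ v) :
    ∑' k : Fin d → ℤ, α (cell l v ⁻¹' {(n, k)}) ≤ α (outer d n) := by
  rw [← measure_iUnion]
  · refine measure_mono (Set.iUnion_subset fun k x hx => ?_)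
    have : shell v x = n := congrArg Prod.fst hx
    exact this ▸ mem_outer_shell hv x
  · intro i j hij
    exact Disjoint.preimage _ (by simpa using hij)
  · exact fun k => measurable_cell_left l v (measurableSet_singleton _)

lemma meanDiscrepancy_le_mass (α β : Measure (Space d)) (l n : ℕ) :
    meanDiscrepancy α β l n ≤ α (outer d n) + β (outer d n) := by
  calc meanDiscrepancy α β l n
      ≤ ∫⁻ _v in Set.Icc (0 : ℝ) 1, (α (outer d n) + β (outer d n)) := by
        refine setLIntegral_mono' measurableSet_Icc fun v hv => ?_
        refine (ENNReal.tsum_le_tsum fun k => absDiff_le_add _ _).trans ?_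
        rw [ENNReal.tsum_add]
        exact add_le_add (tsum_measure_cell_le α l n hv.1) (tsum_measure_cell_le β l n hv.1)
    _ = _ := by rw [lintegral_const, measure_univ, mul_one]

lemma cell_index_mem {l n : ℕ} {v : ℝ} (hv : v ∈ Set.Icc (0 : ℝ) 1) {x : Space d}
    {k : Fin d → ℤ} (h : cell l v x = (n, k)) :
    k ∈ Fintype.piFinset fun _ : Fin d => Finset.Ico (-(2 * 2 ^ l) : ℤ) (3 * 2 ^ l) := by
  rw [Fintype.mem_piFinset]
  intro i
  have hn : shell v x = n := congrArg Prod.fst h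
  have hk : ⌊((2 ^ l : ℕ) : ℝ) * (x i / 2 ^ n + v)⌋ = k i := by
    have := congrFun (congrArg Prod.snd h) i
    simpa only [cell, hn] using this
  have hx : |x i| < 2 * 2 ^ n := by
    have h1 := norm_lt_of_shell hv x
    rw [hn] at h1
    exact lt_of_le_of_lt (by simpa using PiLp.norm_apply_le x i) h1
  rw [abs_lt] at hx
  have h1 : -2 < x i / 2 ^ n := by rw [lt_div_iff₀ (by positivity)]; linarith
  have h2 : x i / 2 ^ n < 2 := by rw [div_lt_iff₀ (by positivity)]; linarith
  have h2l : (0 : ℝ) < 2 ^ l := by positivity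
  rw [Finset.mem_Ico, ← hk, Int.le_floor, Int.floor_lt]
  push_cast
  constructor <;> nlinarith [hv.1, hv.2]

/-- In shell `n` the rescaled and shifted coordinates lie between `-2` and `3`, so at most `(5 *
2^l)^d` cells are nonempty; Cauchy–Schwarz over these gives the factor. -/
lemma discrepancy_sq_le (α β : Measure (Space d)) (l n : ℕ) {v : ℝ}
    (hv : v ∈ Set.Icc (0 : ℝ) 1) :
    discrepancy α β l n v ^ 2 ≤ (5 * 2 ^ l) ^ d *
      ∑' k : Fin d → ℤ, absDiff (α (cell l v ⁻¹' {(n, k)})) (β (cell l v ⁻¹' {(n, k)})) ^ 2 := by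
  set K := Fintype.piFinset fun _ : Fin d => Finset.Ico (-(2 * 2 ^ l) : ℤ) (3 * 2 ^ l) with hK
  have hcard : (K.card : ℝ≥0∞) = (5 * 2 ^ l) ^ d := by
    rw [hK, Fintype.card_piFinset_const, Int.card_Ico]
    have : (3 * 2 ^ l - -(2 * 2 ^ l) : ℤ).toNat = 5 * 2 ^ l := by
      have : (3 * 2 ^ l - -(2 * 2 ^ l) : ℤ) = ((5 * 2 ^ l : ℕ) : ℤ) := by push_cast; ring
      rw [this, Int.toNat_natCast]
    rw [this]
    push_cast
    rfl
  have hzero : ∀ k ∉ K,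
      absDiff (α (cell l v ⁻¹' {(n, k)})) (β (cell l v ⁻¹' {(n, k)})) = 0 := by
    intro k hk
    have : cell (d := d) l v ⁻¹' {(n, k)} = ∅ := by
      refine Set.eq_empty_of_forall_notMem fun x hx => hk (cell_index_mem hv hx)
    simp [this, absDiff]
  rw [discrepancy, tsum_eq_sum hzero, ← hcard]
  have h := ENNReal.rpow_sum_le_const_mul_sum_rpow K
    (fun k => absDiff (α (cell l v ⁻¹' {(n, k)})) (β (cell l v ⁻¹' {(n, k)}))) one_le_two
  norm_num at h
  refine h.trans ?_
  gcongr
  exact ENNReal.sum_le_tsum _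

/-- The indicator of `x` and `y` lying in a common cell of level `l` in the shell `n`. -/
def sameCell (l n : ℕ) (v : ℝ) (x y : Space d) : ℝ≥0∞ :=
  open scoped Classical in if shell v x = n ∧ cell l v x = cell l v y then 1 else 0

/-- The probability that `x` and `y` lie in a common cell of level `l` in the shell `n`. -/
def cellKernel (l n : ℕ) (x y : Space d) : ℝ≥0∞ :=
  ∫⁻ v in Set.Icc (0 : ℝ) 1, sameCell l n v x y

lemma measurable_cell_comp (l : ℕ) {F : Type*} [MeasurableSpace F] {v : F → ℝ}
    {x : F → Space d} (hv : Measurable v) (hx : Measurable x) :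
    Measurable fun z => cell l (v z) (x z) :=
  Measurable.comp (f := fun z => (v z, x z)) (g := fun z : ℝ × Space d => cell l z.1 z.2)
    (measurable_cell l) (hv.prodMk hx)

lemma measurable_shell_comp {F : Type*} [MeasurableSpace F] {v : F → ℝ}
    {x : F → Space d} (hv : Measurable v) (hx : Measurable x) :
    Measurable fun z => shell (v z) (x z) :=
  Measurable.comp (f := fun z => (v z, x z)) (g := fun z : ℝ × Space d => shell z.1 z.2)
    measurable_shell (hv.prodMk hx)

lemma measurable_sameCell_comp (l n : ℕ) {F : Type*} [MeasurableSpace F] {v : F → ℝ}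
    {x y : F → Space d} (hv : Measurable v) (hx : Measurable x) (hy : Measurable y) :
    Measurable fun z => sameCell l n (v z) (x z) (y z) := by
  refine Measurable.ite ?_ measurable_const measurable_const
  exact (measurable_shell_comp hv hx (measurableSet_singleton n)).inter
    (measurableSet_eq_fun_countable (measurable_cell_comp l hv hx) (measurable_cell_comp l hv hy))

lemma measurable_cellKernel (l n : ℕ) :
    Measurable (Function.uncurry (cellKernel (d := d) l n)) :=
  Measurable.lintegral_prod_right' (f := fun z : (Space d × Space d) × ℝ =>
    sameCell l n z.2 z.1.1 z.1.2) (measurable_sameCell_comp l n measurable_snd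
      (measurable_fst.comp measurable_fst) (measurable_snd.comp measurable_fst))

lemma cellKernel_comm (l n : ℕ) (x y : Space d) : cellKernel l n x y = cellKernel l n y x := by
  refine lintegral_congr fun v => ?_
  unfold sameCell
  refine if_congr ⟨?_, ?_⟩ rfl rfl
  · rintro ⟨rfl, h⟩; exact ⟨(congrArg Prod.fst h).symm, h.symm⟩
  · rintro ⟨rfl, h⟩; exact ⟨(congrArg Prod.fst h).symm, h.symm⟩

lemma sameCell_eq_tsum (l n : ℕ) (v : ℝ) (x y : Space d) :
    sameCell l n v x y = ∑' k : Fin d → ℤ, (cell l v ⁻¹' {(n, k)}).indicator 1 x *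
      (cell l v ⁻¹' {(n, k)}).indicator 1 y := by
  by_cases h : shell v x = n
  · rw [tsum_eq_single (cell l v x).2]
    · have hx : cell l v x = (n, (cell l v x).2) := Prod.ext h rfl
      rw [Set.indicator_of_mem (s := cell l v ⁻¹' {(n, (cell l v x).2)}) hx, Pi.one_apply, one_mul,
        ← hx]
      by_cases hxy : cell l v x = cell l v y
      · rw [sameCell, if_pos ⟨h, hxy⟩, Set.indicator_of_mem (show y ∈ cell l v ⁻¹' {cell l v x} from
          hxy.symm), Pi.one_apply]
      · rw [sameCell, if_neg fun h' => hxy h'.2, Set.indicator_of_notMem]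
        exact fun h' => hxy (Eq.symm h')
    · intro k hk
      rw [Set.indicator_of_notMem, zero_mul]
      intro hx
      exact hk (congrArg Prod.snd hx).symm
  · rw [sameCell, if_neg fun h' => h h'.1, eq_comm, ENNReal.tsum_eq_zero]
    intro k
    rw [Set.indicator_of_notMem, zero_mul]
    intro hx
    exact h (congrArg Prod.fst hx)

/-- By Fubini, since the indicator of sharing a cell is the sum over cells of products of
indicators. -/
lemma lintegral_cellKernel (α β : Measure (Space d)) [SFinite α] [SFinite β] (l n : ℕ) :
    ∫⁻ x, ∫⁻ y, cellKernel l n x y ∂β ∂α = ∫⁻ v in Set.Icc (0 : ℝ) 1,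
      ∑' k : Fin d → ℤ, α (cell l v ⁻¹' {(n, k)}) * β (cell l v ⁻¹' {(n, k)}) := by
  have h1 : ∀ x, ∫⁻ y, cellKernel l n x y ∂β =
      ∫⁻ v in Set.Icc (0 : ℝ) 1, ∫⁻ y, sameCell l n v x y ∂β := by
    intro x
    refine lintegral_lintegral_swap (f := fun y v => sameCell l n v x y) ?_
    exact (measurable_sameCell_comp l n measurable_snd measurable_const measurable_fst).aemeasurable
  simp_rw [h1]
  have hm2 : Measurable fun z : Space d × ℝ => ∫⁻ y, sameCell l n z.2 z.1 y ∂β := by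
    have : Measurable fun z : (Space d × ℝ) × Space d => sameCell l n z.1.2 z.1.1 z.2 :=
      measurable_sameCell_comp l n (measurable_snd.comp measurable_fst)
        (measurable_fst.comp measurable_fst) measurable_snd
    exact this.lintegral_prod_right'
  rw [lintegral_lintegral_swap (f := fun x v => ∫⁻ y, sameCell l n v x y ∂β) hm2.aemeasurable]
  refine lintegral_congr fun v => ?_
  have hc : ∀ k, MeasurableSet (cell (d := d) l v ⁻¹' {(n, k)}) := fun k =>
    measurable_cell_left l v (measurableSet_singleton _)
  have hi : ∀ k, Measurable ((cell (d := d) l v ⁻¹' {(n, k)}).indicator (1 : Space d → ℝ≥0∞)) :=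
    fun k => measurable_one.indicator (hc k)
  simp_rw [sameCell_eq_tsum]
  have h2 : ∀ x, ∫⁻ y, ∑' k : Fin d → ℤ, (cell l v ⁻¹' {(n, k)}).indicator 1 x *
      (cell l v ⁻¹' {(n, k)}).indicator 1 y ∂β = ∑' k : Fin d → ℤ,
      (cell l v ⁻¹' {(n, k)}).indicator 1 x * β (cell l v ⁻¹' {(n, k)}) := by
    intro x
    rw [lintegral_tsum fun k => ((hi k).const_mul _).aemeasurable]
    refine tsum_congr fun k => ?_
    rw [lintegral_const_mul _ (hi k), lintegral_indicator_one (hc k)]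
  simp_rw [h2]
  rw [lintegral_tsum fun k => ((hi k).mul_const _).aemeasurable]
  refine tsum_congr fun k => ?_
  rw [lintegral_mul_const _ (hi k), lintegral_indicator_one (hc k)]

lemma lintegral_cellKernel_ne_top (α β : Measure (Space d)) [IsProbabilityMeasure α]
    [IsProbabilityMeasure β] (l n : ℕ) : ∫⁻ x, ∫⁻ y, cellKernel l n x y ∂β ∂α ≠ ∞ := by
  have hle : ∀ x y : Space d, cellKernel l n x y ≤ 1 := by
    intro x y
    calc cellKernel l n x y ≤ ∫⁻ _v in Set.Icc (0 : ℝ) 1, 1 := by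
          refine lintegral_mono fun v => ?_
          unfold sameCell
          split_ifs
          exacts [le_rfl, zero_le_one]
      _ = 1 := by rw [lintegral_const, measure_univ, mul_one]
  refine ne_top_of_le_ne_top ENNReal.one_ne_top ?_
  calc _ ≤ ∫⁻ _x, ∫⁻ _y, 1 ∂β ∂α := lintegral_mono fun x => lintegral_mono fun y => hle x y
    _ = 1 := by simp

/-- The mean square deviation between `α` and `β` over the cells of level `l` in the shell `n`. -/
def meanSquare (α β : Measure (Space d)) (l n : ℕ) : ℝ≥0∞ :=
  ∫⁻ v in Set.Icc (0 : ℝ) 1, ∑' k : Fin d → ℤ,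
    absDiff (α (cell l v ⁻¹' {(n, k)})) (β (cell l v ⁻¹' {(n, k)})) ^ 2

lemma measurable_tsum_absDiff_sq (α β : Measure (Space d)) [SFinite α] [SFinite β] (l n : ℕ) :
    Measurable fun v : ℝ => ∑' k : Fin d → ℤ,
      absDiff (α (cell l v ⁻¹' {(n, k)})) (β (cell l v ⁻¹' {(n, k)})) ^ 2 :=
  .tsum fun k => (measurable_absDiff_cell α β l (n, k)).pow_const 2

/-- The identity `|a - b|² + 2ab = a² + b²`, summed over cells and averaged over shifts. It is kept
free of subtraction because all terms live in `[0, ∞]`. -/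
lemma meanSquare_add (α β : Measure (Space d)) [IsFiniteMeasure α] [IsFiniteMeasure β] (l n : ℕ) :
    meanSquare α β l n + 2 * ∫⁻ x, ∫⁻ y, cellKernel l n x y ∂β ∂α =
      ∫⁻ x, ∫⁻ y, cellKernel l n x y ∂α ∂α + ∫⁻ x, ∫⁻ y, cellKernel l n x y ∂β ∂β := by
  have hmul : ∀ (γ γ' : Measure (Space d)) [SFinite γ] [SFinite γ'],
      Measurable fun v : ℝ => ∑' k : Fin d → ℤ,
        γ (cell l v ⁻¹' {(n, k)}) * γ' (cell l v ⁻¹' {(n, k)}) := fun γ γ' _ _ =>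
    .tsum fun k => (measurable_measure_cell γ l (n, k)).mul (measurable_measure_cell γ' l (n, k))
  simp only [lintegral_cellKernel]
  rw [meanSquare, ← lintegral_add_left (hmul α α), ← lintegral_const_mul _ (hmul α β),
    ← lintegral_add_left (measurable_tsum_absDiff_sq α β l n)]
  refine lintegral_congr fun v => ?_
  rw [← ENNReal.tsum_mul_left, ← ENNReal.tsum_add, ← ENNReal.tsum_add]
  exact tsum_congr fun k => absDiff_sq_add (measure_ne_top _ _) (measure_ne_top _ _)

lemma meanDiscrepancy_sq_le (α β : Measure (Space d)) [SFinite α] [SFinite β] (l n : ℕ) :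
    meanDiscrepancy α β l n ^ 2 ≤ (5 * 2 ^ l) ^ d * meanSquare α β l n := by
  calc meanDiscrepancy α β l n ^ 2
      ≤ ∫⁻ v in Set.Icc (0 : ℝ) 1, discrepancy α β l n v ^ 2 :=
        sq_lintegral_le_lintegral_sq (measurable_discrepancy α β l n).aemeasurable
    _ ≤ ∫⁻ v in Set.Icc (0 : ℝ) 1, (5 * 2 ^ l) ^ d * ∑' k : Fin d → ℤ,
          absDiff (α (cell l v ⁻¹' {(n, k)})) (β (cell l v ⁻¹' {(n, k)})) ^ 2 :=
        setLIntegral_mono' measurableSet_Icc fun v hv => discrepancy_sq_le α β l n hv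
    _ = _ := by rw [lintegral_const_mul _ (measurable_tsum_absDiff_sq α β l n), meanSquare]

lemma measurableSet_outer (n : ℕ) : MeasurableSet (outer d n) :=
  measurableSet_le measurable_const (by fun_prop)

/-- If `x` and `y` share a cell, either `z` lies in it too or the random grid separates `y` from
`z`, which has probability linear in their distance. This is the Lipschitz bound that makes `W_1`
contractivity applicable. The indicator in `x` supplies the later decay in `n`. -/
lemma cellKernel_le_add (l n : ℕ) (x y z : Space d) :
    cellKernel l n x y ≤ cellKernel l n x z +
      (outer d n).indicator (fun _ => ENNReal.ofReal ((d + 3) * 2 ^ l / 2 ^ n)) x *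
        ‖y - z‖ₑ := by
  have hm : ∀ y z : Space d, MeasurableSet
      {v : ℝ | v ∈ Set.Icc 0 1 ∧ shell v y = n ∧ cell l v y ≠ cell l v z} := by
    intro y z
    have hc : ∀ w : Space d, Measurable fun v : ℝ => cell l v w := fun w =>
      measurable_cell_comp l measurable_id measurable_const
    refine measurableSet_Icc.inter (MeasurableSet.inter ?_ ?_)
    · exact (measurable_fst.comp (hc y)) (measurableSet_singleton n)
    · exact (measurableSet_eq_fun_countable (hc y) (hc z)).compl
  by_cases hx : x ∈ outer d n
  · rw [Set.indicator_of_mem hx]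
    calc cellKernel l n x y ≤ ∫⁻ v in Set.Icc (0 : ℝ) 1, (sameCell l n v x z +
          {v : ℝ | v ∈ Set.Icc 0 1 ∧ shell v y = n ∧ cell l v y ≠ cell l v z}.indicator 1 v) := by
          refine setLIntegral_mono' measurableSet_Icc fun v hv => ?_
          by_cases hxy : shell v x = n ∧ cell l v x = cell l v y
          · by_cases hyz : cell l v y = cell l v z
            · refine le_trans (le_of_eq ?_) le_self_add
              rw [sameCell, sameCell, hyz]
            · refine le_trans (le_of_eq ?_) le_add_self
              have hy : shell v y = n := (congrArg Prod.fst hxy.2).symm.trans hxy.1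
              rw [sameCell, if_pos hxy, Set.indicator_of_mem (show v ∈ {v : ℝ | v ∈ Set.Icc 0 1 ∧
                shell v y = n ∧ cell l v y ≠ cell l v z} from ⟨hv, hy, hyz⟩), Pi.one_apply]
          · rw [sameCell, if_neg hxy]
            exact zero_le
      _ = cellKernel l n x z + (volume.restrict (Set.Icc (0 : ℝ) 1))
            {v : ℝ | v ∈ Set.Icc 0 1 ∧ shell v y = n ∧ cell l v y ≠ cell l v z} := by
          rw [lintegral_add_right _ (measurable_one.indicator (hm y z)),
            lintegral_indicator_one (hm y z), cellKernel]
      _ ≤ _ := by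
          gcongr
          exact (Measure.restrict_apply_le _ _).trans (volume_cell_separated_le l n y z)
  · rw [Set.indicator_of_notMem hx, zero_mul, add_zero]
    refine le_trans (le_of_eq ?_) zero_le
    have : cellKernel l n x y = ∫⁻ _v in Set.Icc (0 : ℝ) 1, 0 := by
      refine setLIntegral_congr_fun measurableSet_Icc fun v hv => ?_
      refine if_neg fun h => hx ?_
      rw [← h.1]
      exact mem_outer_shell hv.1 x
    rw [this, lintegral_zero]

end Multiscale

/-! ### Testing Lipschitz functions against the transport cost of order 1. -/

section Transport

variable {d : ℕ}

lemma transportCost_dirac_le (x : Space d) (μ : Measure (Space d)) [IsProbabilityMeasure μ] :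
    transportCost 1 (Measure.dirac x) μ ≤ ‖x‖ₑ + ∫⁻ y, ‖y‖ₑ ∂μ := by
  have hcpl : IsCoupling ((Measure.dirac x).prod μ) (Measure.dirac x) μ :=
    ⟨by rw [Measure.map_fst_prod, measure_univ, one_smul],
      by rw [Measure.map_snd_prod, measure_univ, one_smul]⟩
  refine le_trans (b := ∫⁻ z, ‖z.1 - z.2‖ₑ ^ (1 : ℝ) ∂((Measure.dirac x).prod μ)) ?_ ?_
  · exact iInf₂_le_of_le _ hcpl le_rfl
  rw [lintegral_prod _ (by fun_prop), lintegral_dirac' _ (by fun_prop)]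
  calc ∫⁻ y, ‖x - y‖ₑ ^ (1 : ℝ) ∂μ ≤ ∫⁻ y, (‖x‖ₑ + ‖y‖ₑ) ∂μ := by
          refine lintegral_mono fun y => ?_
          rw [ENNReal.rpow_one]
          exact enorm_sub_le
      _ = ‖x‖ₑ + ∫⁻ y, ‖y‖ₑ ∂μ := by
          rw [lintegral_add_left measurable_const, lintegral_const, measure_univ, mul_one]

/-- The easy half of Kantorovich duality. The strict inequality provides a coupling of cost below
`D` without any existence theorem for optimal couplings. -/
lemma lintegral_le_add_of_transportCost_lt {ν₀ ν₁ : Measure (Space d)} {g : Space d → ℝ≥0∞}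
    (hg : Measurable g) {k D : ℝ≥0∞} (hlip : ∀ y z, g y ≤ g z + k * ‖y - z‖ₑ)
    (hD : transportCost 1 ν₀ ν₁ < D) : ∫⁻ y, g y ∂ν₀ ≤ ∫⁻ z, g z ∂ν₁ + k * D := by
  obtain ⟨π, h⟩ := iInf_lt_iff.1 hD
  obtain ⟨⟨h1, h2⟩, h⟩ := iInf_lt_iff.1 h
  rw [← h1, ← h2, lintegral_map hg measurable_fst, lintegral_map hg measurable_snd]
  calc ∫⁻ z, g z.1 ∂π ≤ ∫⁻ z, (g z.2 + k * ‖z.1 - z.2‖ₑ ^ (1 : ℝ)) ∂π := by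
        refine lintegral_mono fun z => ?_
        rw [ENNReal.rpow_one]
        exact hlip _ _
    _ = ∫⁻ z, g z.2 ∂π + k * ∫⁻ z, ‖z.1 - z.2‖ₑ ^ (1 : ℝ) ∂π := by
        rw [lintegral_add_left (f := fun z : Space d × Space d => g z.2) (hg.comp measurable_snd),
          lintegral_const_mul _ (by fun_prop)]
    _ ≤ _ := by gcongr

end Transport

lemma lintegral_exp_neg_mul_abs_lt_top {lam : ℝ} (hlam : 0 < lam) :
    ∫⁻ t : ℝ, ENNReal.ofReal (Real.exp (-lam * |t|)) < ∞ := by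
  have h1 : ∫⁻ t in Set.Ioi (0 : ℝ), ENNReal.ofReal (Real.exp (-lam * |t|)) < ∞ := by
    have h := (exp_neg_integrableOn_Ioi 0 hlam).lintegral_lt_top
    refine lt_of_le_of_lt (le_of_eq ?_) h
    refine setLIntegral_congr_fun measurableSet_Ioi fun t ht => ?_
    simp only [abs_of_pos (Set.mem_Ioi.1 ht)]
  have h2 : ∫⁻ t in Set.Iic (0 : ℝ), ENNReal.ofReal (Real.exp (-lam * |t|)) < ∞ := by
    have h := (integrableOn_exp_mul_Iic hlam 0).lintegral_lt_top
    refine lt_of_le_of_lt (le_of_eq ?_) h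
    refine setLIntegral_congr_fun measurableSet_Iic fun t ht => ?_
    simp only [abs_of_nonpos (Set.mem_Iic.1 ht)]
    ring_nf
  rw [← lintegral_add_compl _ (measurableSet_Ioi (a := (0 : ℝ))), Set.compl_Ioi]
  exact ENNReal.add_lt_top.2 ⟨h1, h2⟩

/-! ### Stationarity and exponential decorrelation. -/

namespace MarkovProcess

variable {d : ℕ} {Ω : Type*} [MeasurableSpace Ω] (M : MarkovProcess d Ω)
  {μ : Measure (Space d)}

lemma measurable_X_time (t : ℝ≥0) : Measurable (M.X t) :=
  M.measurable_X.comp measurable_prodMk_left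

lemma isProbabilityMeasure_lawFrom [IsProbabilityMeasure μ] :
    IsProbabilityMeasure (M.lawFrom μ) := by
  have := M.isMarkovKernel_law
  constructor
  rw [lawFrom, Measure.bind_apply .univ M.law.aemeasurable]
  simp

lemma isMarkovKernel_transition (t : ℝ≥0) : IsMarkovKernel (M.transition t) := by
  have := M.isMarkovKernel_law
  exact Kernel.IsMarkovKernel.map _ (M.measurable_X_time t)

lemma map_X_lawFrom (hμ : M.IsInvariant μ) (t : ℝ≥0) : (M.lawFrom μ).map (M.X t) = μ := by
  have hX := M.measurable_X_time t
  ext A hA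
  rw [Measure.map_apply hX hA, lawFrom, Measure.bind_apply (hX hA) M.law.aemeasurable]
  conv_rhs => rw [← (hμ.2 t).def, Measure.bind_apply hA (Kernel.aemeasurable _)]
  refine lintegral_congr fun x => ?_
  rw [transition, Kernel.map_apply' _ hX _ hA]

lemma map_X_pair_lawFrom (hμ : M.IsInvariant μ) (s τ : ℝ≥0) :
    (M.lawFrom μ).map (fun ω => (M.X s ω, M.X (s + τ) ω)) = μ ⊗ₘ M.transition τ := by
  have := hμ.1
  have := M.isProbabilityMeasure_lawFrom (μ := μ)
  have := M.isMarkovKernel_transition τ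
  have := M.isMarkovKernel_law
  have hX := M.measurable_X_time
  refine Measure.ext_prod fun {A B} hA hB => ?_
  rw [Measure.map_apply ((hX s).prodMk (hX (s + τ))) (hA.prod hB),
    Measure.compProd_apply_prod hA hB]
  have hset : (fun ω => (M.X s ω, M.X (s + τ) ω)) ⁻¹' A ×ˢ B
      = M.X s ⁻¹' A ∩ M.X (s + τ) ⁻¹' B := rfl
  have hf : Measurable fun y => M.transition τ y B := Kernel.measurable_coe _ hB
  have hA' : MeasurableSet (M.X s ⁻¹' A) := hX s hA
  have hAs : MeasurableSet[⨆ u : Set.Iic s, MeasurableSpace.comap (M.X u) inferInstance]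
      (M.X s ⁻¹' A) :=
    le_iSup (fun u : Set.Iic s => MeasurableSpace.comap (M.X u) inferInstance) ⟨s, Set.self_mem_Iic⟩ _
      ⟨A, hA, rfl⟩
  rw [hset, lawFrom, Measure.bind_apply (hA'.inter (hX _ hB)) M.law.aemeasurable]
  calc ∫⁻ x, M.law x (M.X s ⁻¹' A ∩ M.X (s + τ) ⁻¹' B) ∂μ
      = ∫⁻ x, ∫⁻ ω, (A.indicator fun y => M.transition τ y B) (M.X s ω) ∂(M.law x) ∂μ := by
        refine lintegral_congr fun x => ?_
        rw [M.markov x s τ B _ hB hAs, ← lintegral_indicator hA']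
        refine lintegral_congr fun ω => ?_
        by_cases h : M.X s ω ∈ A
        · rw [Set.indicator_of_mem (s := M.X s ⁻¹' A) h, Set.indicator_of_mem h, transition,
            Kernel.map_apply' _ (hX τ) _ hB]
        · rw [Set.indicator_of_notMem (s := M.X s ⁻¹' A) h, Set.indicator_of_notMem h]
    _ = ∫⁻ ω, (A.indicator fun y => M.transition τ y B) (M.X s ω) ∂(M.lawFrom μ) := by
        rw [lawFrom, Measure.lintegral_bind M.law.aemeasurable]
        exact ((hf.indicator hA).comp (hX s)).aemeasurable
    _ = ∫⁻ y in A, M.transition τ y B ∂μ := by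
        rw [← lintegral_indicator hA, ← lintegral_map (hf.indicator hA) (hX s),
          M.map_X_lawFrom hμ]

/-- Contractivity is applied to the initial law `δ_x`, with invariance replacing `μ P_τ` by `μ`. The
summand `1` in `1 + ‖x‖ₑ` makes the inequality strict. -/
lemma exists_transportCost_transition_lt (hμ : M.IsInvariant μ) (hcontr : M.IsExpContractive μ)
    (hmom : ∫⁻ x, ‖x‖ₑ ∂μ ≠ ∞) :
    ∃ (C : ℝ≥0∞) (lam : ℝ), C ≠ ∞ ∧ 0 < lam ∧ ∀ x (τ : ℝ≥0),
      transportCost 1 (M.transition τ x) μ <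
        C * ENNReal.ofReal (Real.exp (-lam * τ)) * (1 + ‖x‖ₑ) := by
  obtain ⟨C, lam, hC, hlam, h⟩ := hcontr
  have := hμ.1
  refine ⟨ENNReal.ofReal C * (1 + ∫⁻ x, ‖x‖ₑ ∂μ), lam, ?_, hlam, fun x τ => ?_⟩
  · exact ENNReal.mul_ne_top ENNReal.ofReal_ne_top (ENNReal.add_ne_top.2 ⟨ENNReal.one_ne_top, hmom⟩)
  · have h1 := h (Measure.dirac x) inferInstance τ
    rw [Measure.dirac_bind (Kernel.measurable _), (hμ.2 τ).def] at h1
    simp only [wasserstein, ne_eq, one_ne_zero, not_false_eq_true, div_self, min_self,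
      ENNReal.rpow_one] at h1
    rw [ENNReal.ofReal_mul (by linarith)] at h1
    set A := ENNReal.ofReal C * ENNReal.ofReal (Real.exp (-lam * τ)) with hA
    have hA0 : A ≠ 0 := by
      refine mul_ne_zero ?_ ?_ <;> rw [ne_eq, ENNReal.ofReal_eq_zero, not_le]
      · linarith
      · positivity
    have hAt : A ≠ ∞ := ENNReal.mul_ne_top ENNReal.ofReal_ne_top ENNReal.ofReal_ne_top
    set m := ∫⁻ x, ‖x‖ₑ ∂μ
    calc transportCost 1 (M.transition τ x) μ ≤ A * transportCost 1 (Measure.dirac x) μ := h1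
      _ ≤ A * (‖x‖ₑ + m) := by gcongr; exact transportCost_dirac_le x μ
      _ < A * (1 + (‖x‖ₑ + m)) := by
          refine ENNReal.mul_lt_mul_right hA0 hAt ?_
          rw [add_comm 1]
          exact ENNReal.lt_add_right (ENNReal.add_ne_top.2 ⟨enorm_ne_top, hmom⟩) one_ne_zero
      _ ≤ A * ((1 + m) * (1 + ‖x‖ₑ)) := by
          gcongr
          calc 1 + (‖x‖ₑ + m) ≤ 1 + (‖x‖ₑ + m) + m * ‖x‖ₑ := le_self_add
            _ = (1 + m) * (1 + ‖x‖ₑ) := by ring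
      _ = _ := by rw [hA]; ring

/-- Conditionally on `X_s = x`, the later point has law `P_τ(x, ·)`, and replacing this by `μ` costs
the Lipschitz constant `κ x` times the transport distance. -/
lemma lintegral_pair_le (hμ : M.IsInvariant μ) {G : Space d → Space d → ℝ≥0∞}
    (hG : Measurable (Function.uncurry G)) {κ D : Space d → ℝ≥0∞}
    (hlip : ∀ x y z, G x y ≤ G x z + κ x * ‖y - z‖ₑ) (s τ : ℝ≥0)
    (hD : ∀ x, transportCost 1 (M.transition τ x) μ < D x) :
    ∫⁻ ω, G (M.X s ω) (M.X (s + τ) ω) ∂(M.lawFrom μ) ≤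
      ∫⁻ x, ∫⁻ y, G x y ∂μ ∂μ + ∫⁻ x, κ x * D x ∂μ := by
  have := hμ.1
  have := M.isMarkovKernel_transition τ
  have hX := M.measurable_X_time
  have h1 := lintegral_map (μ := M.lawFrom μ) hG ((hX s).prodMk (hX (s + τ)))
  rw [M.map_X_pair_lawFrom hμ, Measure.lintegral_compProd hG] at h1
  simp only [Function.uncurry_apply_pair] at h1
  rw [← h1, ← lintegral_add_left (Measurable.lintegral_prod_right hG)]
  exact lintegral_mono fun x => lintegral_le_add_of_transportCost_lt
    (hG.comp measurable_prodMk_left) (hlip x) (hD x)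

lemma measurable_X_toNNReal : Measurable fun z : ℝ × Ω => M.X z.1.toNNReal z.2 :=
  M.measurable_X.comp ((measurable_real_toNNReal.comp measurable_fst).prodMk measurable_snd)

lemma isProbabilityMeasure_empiricalMeasure {T : ℝ} (hT : 0 < T) (ω : Ω) :
    IsProbabilityMeasure (M.empiricalMeasure T ω) := by
  constructor
  have hm : Measurable fun t : ℝ => M.X t.toNNReal ω :=
    M.measurable_X_toNNReal.comp measurable_prodMk_right
  rw [empiricalMeasure, Measure.smul_apply, Measure.map_apply hm .univ, Set.preimage_univ,
    Measure.restrict_apply_univ, Real.volume_Icc, sub_zero, smul_eq_mul]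
  exact ENNReal.inv_mul_cancel (by simpa using hT) ENNReal.ofReal_ne_top

lemma lintegral_empiricalMeasure (T : ℝ) (ω : Ω) {f : Space d → ℝ≥0∞} (hf : Measurable f) :
    ∫⁻ x, f x ∂(M.empiricalMeasure T ω) =
      (ENNReal.ofReal T)⁻¹ * ∫⁻ t in Set.Icc 0 T, f (M.X t.toNNReal ω) := by
  have hm : Measurable fun t : ℝ => M.X t.toNNReal ω :=
    M.measurable_X_toNNReal.comp measurable_prodMk_right
  rw [empiricalMeasure, lintegral_smul_measure, lintegral_map hf hm, smul_eq_mul]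

lemma measurable_lintegral_empiricalMeasure (T : ℝ) {f : Space d → ℝ≥0∞} (hf : Measurable f) :
    Measurable fun ω => ∫⁻ x, f x ∂(M.empiricalMeasure T ω) := by
  simp_rw [M.lintegral_empiricalMeasure T _ hf]
  exact ((hf.comp M.measurable_X_toNNReal).lintegral_prod_left').const_mul _

lemma lintegral_lintegral_empiricalMeasure (hμ : M.IsInvariant μ) {T : ℝ} (hT : 0 < T)
    {f : Space d → ℝ≥0∞} (hf : Measurable f) :
    ∫⁻ ω, ∫⁻ x, f x ∂(M.empiricalMeasure T ω) ∂(M.lawFrom μ) = ∫⁻ x, f x ∂μ := by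
  have := hμ.1
  have := M.isProbabilityMeasure_lawFrom (μ := μ)
  have hm : Measurable fun z : ℝ × Ω => f (M.X z.1.toNNReal z.2) :=
    hf.comp M.measurable_X_toNNReal
  simp_rw [M.lintegral_empiricalMeasure T _ hf]
  rw [lintegral_const_mul _ hm.lintegral_prod_left']
  dsimp only
  rw [lintegral_lintegral_swap (f := fun (ω : Ω) (t : ℝ) => f (M.X t.toNNReal ω))
    (hm.comp measurable_swap).aemeasurable]
  have : ∀ t : ℝ, ∫⁻ ω, f (M.X t.toNNReal ω) ∂(M.lawFrom μ) = ∫⁻ x, f x ∂μ := fun t => by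
    rw [← lintegral_map hf (M.measurable_X_time _), M.map_X_lawFrom hμ]
  simp_rw [this]
  rw [lintegral_const, Measure.restrict_apply_univ, Real.volume_Icc, sub_zero, mul_comm, mul_assoc,
    ENNReal.mul_inv_cancel (by simpa using hT) ENNReal.ofReal_ne_top, mul_one]

lemma lintegral_lintegral_empiricalMeasure_eq (T : ℝ) (ω : Ω) {G : Space d → Space d → ℝ≥0∞}
    (hG : Measurable (Function.uncurry G)) :
    ∫⁻ x, ∫⁻ y, G x y ∂(M.empiricalMeasure T ω) ∂(M.empiricalMeasure T ω) =
      (ENNReal.ofReal T)⁻¹ * ((ENNReal.ofReal T)⁻¹ *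
        ∫⁻ s in Set.Icc 0 T, ∫⁻ t in Set.Icc 0 T, G (M.X s.toNNReal ω) (M.X t.toNNReal ω)) := by
  have hX : Measurable fun t : ℝ => M.X t.toNNReal ω :=
    M.measurable_X_toNNReal.comp measurable_prodMk_right
  have hm : Measurable fun z : Space d × ℝ => G z.1 (M.X z.2.toNNReal ω) :=
    hG.comp (measurable_fst.prodMk (hX.comp measurable_snd))
  have h1 : ∀ x, ∫⁻ y, G x y ∂(M.empiricalMeasure T ω) =
      (ENNReal.ofReal T)⁻¹ * ∫⁻ t in Set.Icc 0 T, G x (M.X t.toNNReal ω) := fun x =>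
    M.lintegral_empiricalMeasure T ω (hG.comp measurable_prodMk_left)
  simp_rw [h1]
  rw [lintegral_const_mul _ hm.lintegral_prod_right',
    M.lintegral_empiricalMeasure T ω hm.lintegral_prod_right']

lemma measurable_double_lintegral_empiricalMeasure (T : ℝ) {G : Space d → Space d → ℝ≥0∞}
    (hG : Measurable (Function.uncurry G)) :
    Measurable fun ω =>
      ∫⁻ x, ∫⁻ y, G x y ∂(M.empiricalMeasure T ω) ∂(M.empiricalMeasure T ω) := by
  simp_rw [M.lintegral_lintegral_empiricalMeasure_eq T _ hG]
  have hX := M.measurable_X_toNNReal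
  have h3 : Measurable fun z : (Ω × ℝ) × ℝ =>
      G (M.X z.1.2.toNNReal z.1.1) (M.X z.2.toNNReal z.1.1) :=
    hG.comp ((hX.comp ((measurable_snd.comp measurable_fst).prodMk
      (measurable_fst.comp measurable_fst))).prodMk
      (hX.comp (measurable_snd.prodMk (measurable_fst.comp measurable_fst))))
  exact ((h3.lintegral_prod_right').lintegral_prod_right'.const_mul _).const_mul _

/-- Decorrelation of the empirical measure of an exponentially contractive Markov process, tested
against a symmetric kernel which is Lipschitz in its second argument. -/
lemma exists_lintegral_empiricalMeasure_pair_le (hμ : M.IsInvariant μ)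
    (hcontr : M.IsExpContractive μ) (hmom : ∫⁻ x, ‖x‖ₑ ∂μ ≠ ∞) :
    ∃ C : ℝ≥0∞, C ≠ ∞ ∧ ∀ (T : ℝ), 0 < T → ∀ (G : Space d → Space d → ℝ≥0∞)
      (κ : Space d → ℝ≥0∞), Measurable (Function.uncurry G) → Measurable κ →
      (∀ x y, G x y = G y x) → (∀ x y z, G x y ≤ G x z + κ x * ‖y - z‖ₑ) →
      ∫⁻ ω, ∫⁻ x, ∫⁻ y, G x y ∂(M.empiricalMeasure T ω) ∂(M.empiricalMeasure T ω) ∂(M.lawFrom μ) ≤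
        ∫⁻ x, ∫⁻ y, G x y ∂μ ∂μ + C * (ENNReal.ofReal T)⁻¹ * ∫⁻ x, κ x * (1 + ‖x‖ₑ) ∂μ := by
  obtain ⟨C, lam, hC, hlam, hD⟩ := M.exists_transportCost_transition_lt hμ hcontr hmom
  have := hμ.1
  have := M.isProbabilityMeasure_lawFrom (μ := μ)
  set Λ := ∫⁻ t : ℝ, ENNReal.ofReal (Real.exp (-lam * |t|)) with hΛ
  have hΛtop : Λ ≠ ∞ := (lintegral_exp_neg_mul_abs_lt_top hlam).ne
  refine ⟨C * Λ, ENNReal.mul_ne_top hC hΛtop, fun T hT G κ hG hκ hsymm hlip => ?_⟩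
  set I := ∫⁻ x, ∫⁻ y, G x y ∂μ ∂μ
  set J := ∫⁻ x, κ x * (1 + ‖x‖ₑ) ∂μ
  have hle : ∀ s t : ℝ, 0 ≤ s → s ≤ t →
      ∫⁻ ω, G (M.X s.toNNReal ω) (M.X t.toNNReal ω) ∂(M.lawFrom μ) ≤
        I + C * J * ENNReal.ofReal (Real.exp (-lam * |t - s|)) := by
    intro s t hs hst
    have h := M.lintegral_pair_le hμ hG hlip s.toNNReal (t - s).toNNReal
      (fun x => hD x (t - s).toNNReal)
    rw [← Real.toNNReal_add hs (by linarith), add_sub_cancel] at h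
    refine h.trans (le_of_eq ?_)
    congr 1
    rw [Real.coe_toNNReal _ (by linarith), abs_of_nonneg (by linarith), mul_right_comm,
      ← lintegral_const_mul _ (by fun_prop)]
    refine lintegral_congr fun x => ?_
    ring
  have hle' : ∀ s ∈ Set.Icc 0 T, ∀ t ∈ Set.Icc 0 T,
      ∫⁻ ω, G (M.X s.toNNReal ω) (M.X t.toNNReal ω) ∂(M.lawFrom μ) ≤
        I + C * J * ENNReal.ofReal (Real.exp (-lam * |t - s|)) := by
    intro s hs t ht
    -- The estimate conditions on the earlier time; the symmetry of `G` handles the other order.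
    rcases le_total s t with h | h
    · exact hle s t hs.1 h
    · have := hle t s ht.1 h
      rw [abs_sub_comm] at this
      refine le_trans (le_of_eq ?_) this
      exact lintegral_congr fun ω => hsymm _ _
  have hX := M.measurable_X_toNNReal
  have h3 : Measurable fun z : (Ω × ℝ) × ℝ =>
      G (M.X z.1.2.toNNReal z.1.1) (M.X z.2.toNNReal z.1.1) :=
    hG.comp ((hX.comp ((measurable_snd.comp measurable_fst).prodMk
      (measurable_fst.comp measurable_fst))).prodMk
      (hX.comp (measurable_snd.prodMk (measurable_fst.comp measurable_fst))))
  simp_rw [M.lintegral_lintegral_empiricalMeasure_eq T _ hG]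
  have hT0 : ENNReal.ofReal T ≠ 0 := by simpa using hT
  have hTt : ENNReal.ofReal T ≠ ∞ := ENNReal.ofReal_ne_top
  rw [lintegral_const_mul _ (h3.lintegral_prod_right'.lintegral_prod_right'.const_mul _),
    lintegral_const_mul _ h3.lintegral_prod_right'.lintegral_prod_right',
    lintegral_lintegral_swap h3.lintegral_prod_right'.aemeasurable]
  have hswap : ∀ s : ℝ, ∫⁻ ω, (∫⁻ t in Set.Icc 0 T, G (M.X s.toNNReal ω) (M.X t.toNNReal ω))
      ∂(M.lawFrom μ) = ∫⁻ t in Set.Icc 0 T, ∫⁻ ω, G (M.X s.toNNReal ω) (M.X t.toNNReal ω)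
      ∂(M.lawFrom μ) := fun s => by
    rw [lintegral_lintegral_swap]
    exact (h3.comp ((measurable_fst.prodMk measurable_const).prodMk measurable_snd)).aemeasurable
  simp_rw [hswap]
  have hvol : volume (Set.Icc 0 T) = ENNReal.ofReal T := by rw [Real.volume_Icc, sub_zero]
  have hinner : ∀ s ∈ Set.Icc 0 T, ∫⁻ t in Set.Icc 0 T, ∫⁻ ω, G (M.X s.toNNReal ω)
      (M.X t.toNNReal ω) ∂(M.lawFrom μ) ≤ I * ENNReal.ofReal T + C * J * Λ := by
    -- The correlation error is integrable over all time lags, so it contributes order `T` to the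
    -- double time integral, hence order `T⁻¹` after normalisation.
    intro s hs
    calc _ ≤ ∫⁻ t in Set.Icc 0 T, (I + C * J * ENNReal.ofReal (Real.exp (-lam * |t - s|))) :=
          setLIntegral_mono' measurableSet_Icc fun t ht => hle' s hs t ht
      _ = I * ENNReal.ofReal T +
            C * J * ∫⁻ t in Set.Icc 0 T, ENNReal.ofReal (Real.exp (-lam * |t - s|)) := by
          rw [lintegral_add_left measurable_const, lintegral_const, Measure.restrict_apply_univ,
            hvol, lintegral_const_mul _ (by fun_prop)]
      _ ≤ I * ENNReal.ofReal T + C * J * ∫⁻ t : ℝ, ENNReal.ofReal (Real.exp (-lam * |t - s|)) := by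
          gcongr
          exact Measure.restrict_le_self
      _ = I * ENNReal.ofReal T + C * J * Λ := by
          rw [lintegral_sub_right_eq_self (fun t : ℝ => ENNReal.ofReal (Real.exp (-lam * |t|)))]
  set τ := ENNReal.ofReal T
  calc _ ≤ τ⁻¹ * (τ⁻¹ * ∫⁻ s in Set.Icc 0 T, (I * τ + C * J * Λ)) := by
        gcongr τ⁻¹ * (τ⁻¹ * ?_)
        exact setLIntegral_mono' measurableSet_Icc hinner
    _ = (τ⁻¹ * τ) * (τ⁻¹ * τ) * I + (τ⁻¹ * τ) * τ⁻¹ * (C * J * Λ) := by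
        rw [lintegral_const, Measure.restrict_apply_univ, hvol]
        ring
    _ = _ := by
        rw [ENNReal.inv_mul_cancel hT0 hTt]
        ring

end MarkovProcess

/-! ### Interpolation, geometric series and moment bounds. -/

lemma le_rpow_mul_rpow_of_le_of_sq_le {x A B : ℝ≥0∞} {θ : ℝ} (h0 : 0 ≤ θ) (h1 : 2 * θ ≤ 1)
    (hA : x ≤ A) (hB : x ^ 2 ≤ B) : x ≤ A ^ (1 - 2 * θ) * B ^ θ := by
  calc x = x ^ (1 - 2 * θ) * (x ^ 2) ^ θ := by
        rw [← ENNReal.rpow_two, ← ENNReal.rpow_mul,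
          ← ENNReal.rpow_add_of_nonneg _ _ (by linarith) (by linarith), sub_add_cancel,
          ENNReal.rpow_one]
    _ ≤ _ := mul_le_mul' (ENNReal.rpow_le_rpow hA (by linarith)) (ENNReal.rpow_le_rpow hB h0)

lemma tsum_two_pow_rpow_ne_top {e : ℝ} (he : e < 0) : ∑' n : ℕ, ((2 : ℝ≥0∞) ^ n) ^ e ≠ ∞ := by
  have h : ∀ n : ℕ, ((2 : ℝ≥0∞) ^ n) ^ e = ((2 : ℝ≥0∞) ^ e) ^ n := fun n => by
    rw [← ENNReal.rpow_natCast, ← ENNReal.rpow_natCast, ← ENNReal.rpow_mul, ← ENNReal.rpow_mul,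
      mul_comm]
  simp_rw [h]
  rw [ENNReal.tsum_geometric, ne_eq, ENNReal.inv_eq_top, tsub_eq_zero_iff_le, not_le]
  exact ENNReal.rpow_lt_one_of_one_lt_of_neg ENNReal.one_lt_two he

lemma two_pow_rpow_add (n : ℕ) (a b : ℝ) :
    ((2 : ℝ≥0∞) ^ n) ^ (a + b) = ((2 : ℝ≥0∞) ^ n) ^ a * ((2 : ℝ≥0∞) ^ n) ^ b :=
  ENNReal.rpow_add _ _ (pow_ne_zero _ two_ne_zero) (ENNReal.pow_ne_top ENNReal.ofNat_ne_top)

section Moments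

variable {d : ℕ}

lemma two_pow_le_of_mem_outer {n : ℕ} {x : Space d} (hx : x ∈ outer d n) :
    (2 : ℝ≥0∞) ^ n ≤ 2 * (1 + ‖x‖ₑ) := by
  have h := ENNReal.ofReal_le_ofReal (show (2 : ℝ) ^ n ≤ 2 * (1 + ‖x‖) from hx)
  rwa [ENNReal.ofReal_pow (by norm_num), ENNReal.ofReal_mul (by norm_num),
    ENNReal.ofReal_add (by norm_num) (norm_nonneg _), ofReal_norm, ENNReal.ofReal_one,
    ENNReal.ofReal_ofNat] at h

/-- Chebyshev's inequality: on `outer d n` the base is at least `2^n`, and the exponent `r - q` is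
not positive. -/
lemma setLIntegral_outer_le (μ : Measure (Space d)) {q r : ℝ} (hrq : r ≤ q) (n : ℕ) :
    ∫⁻ x in outer d n, (2 * (1 + ‖x‖ₑ)) ^ r ∂μ ≤
      ((2 : ℝ≥0∞) ^ n) ^ (r - q) * ∫⁻ x, (2 * (1 + ‖x‖ₑ)) ^ q ∂μ := by
  rw [← lintegral_const_mul _ (by fun_prop)]
  refine (setLIntegral_mono' (measurableSet_outer n) fun x hx => ?_).trans
    (lintegral_mono' Measure.restrict_le_self le_rfl)
  have h0 : 2 * (1 + ‖x‖ₑ) ≠ 0 := by simp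
  have ht : 2 * (1 + ‖x‖ₑ) ≠ ∞ := by finiteness
  calc (2 * (1 + ‖x‖ₑ)) ^ r = (2 * (1 + ‖x‖ₑ)) ^ (r - q) * (2 * (1 + ‖x‖ₑ)) ^ q := by
        rw [← ENNReal.rpow_add _ _ h0 ht, sub_add_cancel]
    _ ≤ _ := by
        gcongr ?_ * _
        rw [← neg_sub q r, ENNReal.rpow_neg, ENNReal.rpow_neg, ENNReal.inv_le_inv]
        exact ENNReal.rpow_le_rpow (two_pow_le_of_mem_outer hx) (by linarith)

lemma lintegral_two_mul_one_add_enorm_rpow_ne_top {μ : Measure (Space d)} [IsFiniteMeasure μ]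
    {q : ℝ} (hq : 0 ≤ q) (h : ∫⁻ x, ‖x‖ₑ ^ q ∂μ ≠ ∞) :
    ∫⁻ x, (2 * (1 + ‖x‖ₑ)) ^ q ∂μ ≠ ∞ := by
  have hle : ∀ x : Space d, (2 * (1 + ‖x‖ₑ)) ^ q ≤ 4 ^ q * (1 + ‖x‖ₑ ^ q) := by
    intro x
    have h4 : ∀ y : ℝ≥0∞, (2 * (y + y)) ^ q = 4 ^ q * y ^ q := fun y => by
      rw [← ENNReal.mul_rpow_of_nonneg _ _ hq]; congr 1; ring
    rcases le_total ‖x‖ₑ 1 with hx | hx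
    · calc (2 * (1 + ‖x‖ₑ)) ^ q ≤ (2 * (1 + 1)) ^ q := by gcongr
        _ = 4 ^ q * 1 := by rw [h4, ENNReal.one_rpow]
        _ ≤ _ := by gcongr; exact le_self_add
    · calc (2 * (1 + ‖x‖ₑ)) ^ q ≤ (2 * (‖x‖ₑ + ‖x‖ₑ)) ^ q := by gcongr
        _ = 4 ^ q * ‖x‖ₑ ^ q := h4 _
        _ ≤ _ := by gcongr; exact le_add_self
  refine ne_top_of_le_ne_top ?_ (lintegral_mono hle)
  rw [lintegral_const_mul _ (by fun_prop), lintegral_add_left measurable_const, lintegral_const]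
  have := measure_ne_top μ Set.univ
  finiteness

end Moments

/-! ### Expected discrepancies and summation over scales. -/

namespace MarkovProcess

variable {d : ℕ} {Ω : Type*} [MeasurableSpace Ω] (M : MarkovProcess d Ω)
  {μ : Measure (Space d)}

lemma measurable_lintegral_cellKernel (ν : Measure (Space d)) [SFinite ν] (l n : ℕ) :
    Measurable fun x => ∫⁻ y, cellKernel l n x y ∂ν :=
  (measurable_cellKernel l n).lintegral_prod_right'

/-- The cross term in `meanSquare_add` is finite, so the mean square is a difference of integrals of
the cell kernel, each measurable in `ω`. -/
lemma measurable_meanSquare (hμ : M.IsInvariant μ) {T : ℝ} (hT : 0 < T) (l n : ℕ) :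
    Measurable fun ω => meanSquare (M.empiricalMeasure T ω) μ l n := by
  have := hμ.1
  have := M.isProbabilityMeasure_empiricalMeasure hT
  have h : ∀ ω, meanSquare (M.empiricalMeasure T ω) μ l n =
      (∫⁻ x, ∫⁻ y, cellKernel l n x y ∂(M.empiricalMeasure T ω) ∂(M.empiricalMeasure T ω) +
        ∫⁻ x, ∫⁻ y, cellKernel l n x y ∂μ ∂μ) -
        2 * ∫⁻ x, ∫⁻ y, cellKernel l n x y ∂μ ∂(M.empiricalMeasure T ω) := fun ω =>
    ENNReal.eq_sub_of_add_eq
      (ENNReal.mul_ne_top ENNReal.ofNat_ne_top (lintegral_cellKernel_ne_top _ _ l n))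
      (meanSquare_add _ _ l n)
  simp_rw [h]
  exact ((M.measurable_double_lintegral_empiricalMeasure T (measurable_cellKernel l n)).add_const
    _).sub ((M.measurable_lintegral_empiricalMeasure T
      (measurable_lintegral_cellKernel μ l n)).const_mul _)

lemma exists_lintegral_meanSquare_le (hμ : M.IsInvariant μ) (hcontr : M.IsExpContractive μ)
    {q : ℝ} (hq : 1 ≤ q) (hmom1 : ∫⁻ x, ‖x‖ₑ ∂μ ≠ ∞) (hmom : ∫⁻ x, ‖x‖ₑ ^ q ∂μ ≠ ∞) :
    ∃ C : ℝ≥0∞, C ≠ ∞ ∧ ∀ T : ℝ, 0 < T → ∀ l n : ℕ,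
      ∫⁻ ω, meanSquare (M.empiricalMeasure T ω) μ l n ∂(M.lawFrom μ) ≤
        C * (ENNReal.ofReal T)⁻¹ * 2 ^ l * ((2 : ℝ≥0∞) ^ n) ^ (-q) := by
  have := hμ.1
  obtain ⟨C, hC, h⟩ := M.exists_lintegral_empiricalMeasure_pair_le hμ hcontr hmom1
  set m := ∫⁻ x, (2 * (1 + ‖x‖ₑ)) ^ q ∂μ with hm
  have hmt : m ≠ ∞ := lintegral_two_mul_one_add_enorm_rpow_ne_top (by linarith) hmom
  refine ⟨C * (d + 3) * m, by finiteness, fun T hT l n => ?_⟩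
  have := M.isProbabilityMeasure_empiricalMeasure hT
  set b := ∫⁻ x, ∫⁻ y, cellKernel l n x y ∂μ ∂μ with hb
  have hbt : b ≠ ∞ := lintegral_cellKernel_ne_top μ μ l n
  set c := ENNReal.ofReal ((d + 3) * 2 ^ l / 2 ^ n) with hc
  have hcross : ∫⁻ ω, ∫⁻ x, ∫⁻ y, cellKernel l n x y ∂μ ∂(M.empiricalMeasure T ω)
      ∂(M.lawFrom μ) = b :=
    M.lintegral_lintegral_empiricalMeasure hμ hT (measurable_lintegral_cellKernel μ l n)
  have hpair := h T hT (cellKernel l n) ((outer d n).indicator fun _ => c)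
    (measurable_cellKernel l n) (measurable_const.indicator (measurableSet_outer n))
    (cellKernel_comm l n) (cellKernel_le_add l n)
  have hJ : ∫⁻ x, (outer d n).indicator (fun _ => c) x * (1 + ‖x‖ₑ) ∂μ ≤
      (d + 3) * m * 2 ^ l * ((2 : ℝ≥0∞) ^ n) ^ (-q) := by
    calc _ = ∫⁻ x in outer d n, c * (1 + ‖x‖ₑ) ∂μ := by
          rw [← lintegral_indicator (measurableSet_outer n)]
          exact lintegral_congr fun x => by
            by_cases hx : x ∈ outer d n <;> simp [hx]
      _ = c * ∫⁻ x in outer d n, (1 + ‖x‖ₑ) ∂μ := lintegral_const_mul _ (by fun_prop)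
      _ ≤ c * ∫⁻ x in outer d n, (2 * (1 + ‖x‖ₑ)) ^ (1 : ℝ) ∂μ := by
          gcongr with x
          rw [ENNReal.rpow_one]
          exact le_mul_of_one_le_left zero_le one_le_two
      _ ≤ c * (((2 : ℝ≥0∞) ^ n) ^ (1 - q) * m) := by
          gcongr
          exact setLIntegral_outer_le μ hq n
      _ = _ := by
          have h2 : c = (d + 3) * 2 ^ l * ((2 : ℝ≥0∞) ^ n) ^ (-1 : ℝ) := by
            rw [hc, div_eq_mul_inv, ENNReal.ofReal_mul (by positivity),
              ENNReal.ofReal_mul (by positivity), ENNReal.ofReal_inv_of_pos (by positivity),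
              ENNReal.ofReal_pow (by norm_num), ENNReal.ofReal_pow (by norm_num),
              ENNReal.ofReal_add (by positivity) (by positivity), ENNReal.ofReal_natCast,
              ENNReal.ofReal_ofNat, ENNReal.ofReal_ofNat, ENNReal.rpow_neg_one]
          have h3 : ((2 : ℝ≥0∞) ^ n) ^ (-q) =
              ((2 : ℝ≥0∞) ^ n) ^ (-1 : ℝ) * ((2 : ℝ≥0∞) ^ n) ^ (1 - q) := by
            rw [← two_pow_rpow_add]; congr 1; ring
          rw [h2, h3]
          ring
  -- By stationarity the cross term has expectation exactly `b`, so the main terms cancel and only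
  -- the correlation error remains. The finite quantity `2 * b` is carried on both sides in place of
  -- a subtraction.
  have hsum : ∫⁻ ω, meanSquare (M.empiricalMeasure T ω) μ l n ∂(M.lawFrom μ) + 2 * b ≤
      C * (ENNReal.ofReal T)⁻¹ * ((d + 3) * m * 2 ^ l * ((2 : ℝ≥0∞) ^ n) ^ (-q)) + 2 * b := by
    have hP := M.isProbabilityMeasure_lawFrom (μ := μ)
    have hYm := M.measurable_lintegral_empiricalMeasure T (measurable_lintegral_cellKernel μ l n)
    calc _ = ∫⁻ ω, (meanSquare (M.empiricalMeasure T ω) μ l n +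
            2 * ∫⁻ x, ∫⁻ y, cellKernel l n x y ∂μ ∂(M.empiricalMeasure T ω)) ∂(M.lawFrom μ) := by
          rw [lintegral_add_right _ (hYm.const_mul _), lintegral_const_mul _ hYm, hcross]
      _ = ∫⁻ ω, ∫⁻ x, ∫⁻ y, cellKernel l n x y ∂(M.empiricalMeasure T ω)
            ∂(M.empiricalMeasure T ω) ∂(M.lawFrom μ) + b := by
          simp_rw [meanSquare_add]
          rw [lintegral_add_right _ measurable_const, lintegral_const, measure_univ, mul_one]
      _ ≤ (b + C * (ENNReal.ofReal T)⁻¹ *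
            ((d + 3) * m * 2 ^ l * ((2 : ℝ≥0∞) ^ n) ^ (-q))) + b := by
          gcongr
          exact hpair.trans (by gcongr)
      _ = _ := by ring
  refine (ENNReal.le_of_add_le_add_right (by finiteness) hsum).trans (le_of_eq ?_)
  ring

/-- The measurable majorant `S` allows sums over scales to be integrated term by term, without
measurability of the discrepancy itself in `ω`. -/
lemma exists_meanDiscrepancy_majorant (hμ : M.IsInvariant μ) (hcontr : M.IsExpContractive μ)
    {q θ : ℝ} (hq : 1 ≤ q) (hmom1 : ∫⁻ x, ‖x‖ₑ ∂μ ≠ ∞) (hmom : ∫⁻ x, ‖x‖ₑ ^ q ∂μ ≠ ∞)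
    (hθ0 : 0 ≤ θ) (hθ1 : 2 * θ ≤ 1) :
    ∃ C : ℝ≥0∞, C ≠ ∞ ∧ ∀ T : ℝ, 0 < T → ∀ l n : ℕ, ∃ S : Ω → ℝ≥0∞, Measurable S ∧
      (∀ ω, meanDiscrepancy (M.empiricalMeasure T ω) μ l n ≤ S ω) ∧
      ∫⁻ ω, S ω ∂(M.lawFrom μ) ≤ C * ENNReal.ofReal T ^ (-θ) * ((2 : ℝ≥0∞) ^ l) ^ (θ * (d + 1)) *
        ((2 : ℝ≥0∞) ^ n) ^ (-(q * (1 - θ))) := by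
  have := hμ.1
  have hP := M.isProbabilityMeasure_lawFrom (μ := μ)
  obtain ⟨C, hC, h⟩ := M.exists_lintegral_meanSquare_le hμ hcontr hq hmom1 hmom
  set m := ∫⁻ x, (2 * (1 + ‖x‖ₑ)) ^ q ∂μ with hm
  have hmt : m ≠ ∞ := lintegral_two_mul_one_add_enorm_rpow_ne_top (by linarith) hmom
  refine ⟨(2 * m) ^ (1 - 2 * θ) * (5 ^ d * C) ^ θ, ?_, fun T hT l n => ?_⟩
  · exact ENNReal.mul_ne_top (ENNReal.rpow_ne_top_of_nonneg (by linarith) (by finiteness))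
      (ENNReal.rpow_ne_top_of_nonneg hθ0 (by finiteness))
  have := M.isProbabilityMeasure_empiricalMeasure hT
  set a : Ω → ℝ≥0∞ := fun ω => M.empiricalMeasure T ω (outer d n) + μ (outer d n) with ha
  set s : Ω → ℝ≥0∞ := fun ω => (5 * 2 ^ l) ^ d * meanSquare (M.empiricalMeasure T ω) μ l n with hs
  have hind : Measurable ((outer d n).indicator (1 : Space d → ℝ≥0∞)) :=
    measurable_one.indicator (measurableSet_outer n)
  have heq : ∀ ω, M.empiricalMeasure T ω (outer d n) =
      ∫⁻ x, (outer d n).indicator 1 x ∂(M.empiricalMeasure T ω) := fun ω =>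
    (lintegral_indicator_one (measurableSet_outer n)).symm
  have hout : Measurable fun ω => M.empiricalMeasure T ω (outer d n) := by
    simp_rw [heq]
    exact M.measurable_lintegral_empiricalMeasure T hind
  have ham : Measurable a := hout.add_const _
  have hsm : Measurable s := (M.measurable_meanSquare hμ hT l n).const_mul _
  have hSm : Measurable fun ω => min (a ω) (s ω ^ (1 / 2 : ℝ)) := ham.min (hsm.pow_const _)
  -- The minimum inherits the first-moment bound from `a`, hence from the tail of `μ`, and the
  -- second-moment bound from `s`, so the two can be interpolated.
  refine ⟨fun ω => min (a ω) (s ω ^ (1 / 2 : ℝ)), hSm, fun ω => le_min ?_ ?_, ?_⟩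
  · exact meanDiscrepancy_le_mass _ _ l n
  · have h2 := ENNReal.rpow_le_rpow (meanDiscrepancy_sq_le (M.empiricalMeasure T ω) μ l n)
      (z := 1 / 2) (by norm_num)
    rwa [← ENNReal.rpow_two, ← ENNReal.rpow_mul, mul_one_div_cancel two_ne_zero,
      ENNReal.rpow_one] at h2
  · have hA : ∫⁻ ω, min (a ω) (s ω ^ (1 / 2 : ℝ)) ∂(M.lawFrom μ) ≤
        2 * m * ((2 : ℝ≥0∞) ^ n) ^ (-q) := by
      have hmass : μ (outer d n) ≤ ((2 : ℝ≥0∞) ^ n) ^ (-q) * m := by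
        have := setLIntegral_outer_le μ (show (0 : ℝ) ≤ q by linarith) n
        simpa using this
      calc _ ≤ ∫⁻ ω, a ω ∂(M.lawFrom μ) := lintegral_mono fun ω => min_le_left _ _
        _ = μ (outer d n) + μ (outer d n) := by
            simp_rw [ha, heq]
            rw [lintegral_add_right _ measurable_const, lintegral_const, measure_univ, mul_one,
              M.lintegral_lintegral_empiricalMeasure hμ hT hind,
              lintegral_indicator_one (measurableSet_outer n)]
        _ ≤ ((2 : ℝ≥0∞) ^ n) ^ (-q) * m + ((2 : ℝ≥0∞) ^ n) ^ (-q) * m := add_le_add hmass hmass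
        _ = _ := by ring
    have hB : (∫⁻ ω, min (a ω) (s ω ^ (1 / 2 : ℝ)) ∂(M.lawFrom μ)) ^ 2 ≤
        5 ^ d * C * (ENNReal.ofReal T)⁻¹ * (2 ^ l) ^ (d + 1) * ((2 : ℝ≥0∞) ^ n) ^ (-q) := by
      calc _ ≤ ∫⁻ ω, min (a ω) (s ω ^ (1 / 2 : ℝ)) ^ 2 ∂(M.lawFrom μ) :=
            sq_lintegral_le_lintegral_sq hSm.aemeasurable
        _ ≤ ∫⁻ ω, s ω ∂(M.lawFrom μ) := by
            refine lintegral_mono fun ω => ?_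
            calc _ ≤ (s ω ^ (1 / 2 : ℝ)) ^ 2 := by gcongr; exact min_le_right _ _
              _ = s ω := by
                rw [← ENNReal.rpow_two, ← ENNReal.rpow_mul, one_div_mul_cancel two_ne_zero,
                  ENNReal.rpow_one]
        _ ≤ (5 * 2 ^ l) ^ d * (C * (ENNReal.ofReal T)⁻¹ * 2 ^ l * ((2 : ℝ≥0∞) ^ n) ^ (-q)) := by
            rw [hs, lintegral_const_mul _ (M.measurable_meanSquare hμ hT l n)]
            gcongr
            exact h T hT l n
        _ = _ := by ring
    refine (le_rpow_mul_rpow_of_le_of_sq_le hθ0 hθ1 hA hB).trans (le_of_eq ?_)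
    have e1 : ((2 : ℝ≥0∞) ^ n) ^ (-(q * (1 - θ))) =
        (((2 : ℝ≥0∞) ^ n) ^ (-q)) ^ (1 - 2 * θ) * (((2 : ℝ≥0∞) ^ n) ^ (-q)) ^ θ := by
      rw [← ENNReal.rpow_mul, ← ENNReal.rpow_mul, ← two_pow_rpow_add]
      congr 1; ring
    have e2 : ((2 : ℝ≥0∞) ^ l) ^ (θ * (d + 1)) = (((2 : ℝ≥0∞) ^ l) ^ (d + 1)) ^ θ := by
      rw [← ENNReal.rpow_natCast ((2 : ℝ≥0∞) ^ l) (d + 1), ← ENNReal.rpow_mul]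
      congr 1; push_cast; ring
    have e3 : ENNReal.ofReal T ^ (-θ) = ((ENNReal.ofReal T)⁻¹) ^ θ := by
      rw [ENNReal.inv_rpow, ENNReal.rpow_neg]
    have h1θ : 0 ≤ 1 - 2 * θ := by linarith
    rw [e1, e2, e3]
    simp only [ENNReal.mul_rpow_of_nonneg _ _ hθ0, ENNReal.mul_rpow_of_nonneg _ _ h1θ]
    ring

lemma exists_mesh_le (d : ℕ) {p : ℝ} (hp : 0 < p) {ε : ℝ≥0∞} (hε : 0 < ε) :
    ∃ L, mesh d p L ≤ ε := by
  have h : Filter.Tendsto (fun l : ℕ => mesh d p l) Filter.atTop (nhds 0) := by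
    have h1 : Filter.Tendsto (fun l : ℕ => (d : ℝ≥0∞) * (2 ^ l)⁻¹) Filter.atTop (nhds 0) := by
      have := ENNReal.Tendsto.const_mul (a := (d : ℝ≥0∞))
        (ENNReal.tendsto_pow_atTop_nhds_zero_of_lt_one (r := 2⁻¹) (by simp))
        (Or.inr (ENNReal.natCast_ne_top d))
      simpa [ENNReal.inv_pow] using this
    have := h1.ennrpow_const p
    rwa [ENNReal.zero_rpow_of_pos hp] at this
  exact ((h.eventually_lt_const hε).exists).imp fun L hL => hL.le

/-- Convergence rate of the empirical measure at any admissible exponent `θ`. -/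
theorem exists_lintegral_transportCost_le (hμ : M.IsInvariant μ) (hcontr : M.IsExpContractive μ)
    {p q θ : ℝ} (hp : 0 < p) (hpq : p ≤ q) (hq : 1 ≤ q) (hmom : ∫⁻ x, ‖x‖ₑ ^ q ∂μ ≠ ∞)
    (hθ0 : 0 ≤ θ) (hθ1 : 2 * θ ≤ 1) (hθq : p < q * (1 - θ)) (hθd : θ * (d + 1) < p) :
    ∃ C : ℝ≥0∞, C ≠ ∞ ∧ ∀ T : ℝ, 0 < T →
      ∫⁻ ω, transportCost p (M.empiricalMeasure T ω) μ ∂(M.lawFrom μ) ≤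
        C * ENNReal.ofReal T ^ (-θ) := by
  have := hμ.1
  have hP := M.isProbabilityMeasure_lawFrom (μ := μ)
  have hpow : ∀ r, 0 ≤ r → r ≤ q → ∫⁻ x, (2 * (1 + ‖x‖ₑ)) ^ r ∂μ ≠ ∞ := by
    intro r hr hrq
    refine ne_top_of_le_ne_top
      (lintegral_two_mul_one_add_enorm_rpow_ne_top (hr.trans hrq) hmom)
      (lintegral_mono fun x => ENNReal.rpow_le_rpow_of_exponent_le ?_ hrq)
    calc (1 : ℝ≥0∞) ≤ 1 * (1 + ‖x‖ₑ) := by rw [one_mul]; exact le_self_add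
      _ ≤ 2 * (1 + ‖x‖ₑ) := by gcongr; exact one_le_two
  have hmom1 : ∫⁻ x, ‖x‖ₑ ∂μ ≠ ∞ := by
    refine ne_top_of_le_ne_top (hpow 1 zero_le_one hq) (lintegral_mono fun x => ?_)
    rw [ENNReal.rpow_one]
    calc ‖x‖ₑ ≤ 1 * (1 + ‖x‖ₑ) := by rw [one_mul]; exact le_add_self
      _ ≤ 2 * (1 + ‖x‖ₑ) := by gcongr; exact one_le_two
  obtain ⟨C, hC, h⟩ := M.exists_meanDiscrepancy_majorant hμ hcontr hq hmom1 hmom hθ0 hθ1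
  set m := ∫⁻ x, (2 * (1 + ‖x‖ₑ)) ^ p ∂μ with hm
  have hmt : m ≠ ∞ := hpow p hp.le hpq
  -- `A` sums over the shells and converges because `p < q * (1 - θ)`; `B` sums over the levels and
  -- converges because `θ * (d + 1) < p`.
  set A := ∑' n : ℕ, ((2 : ℝ≥0∞) ^ n) ^ (p - q * (1 - θ)) with hA
  have hAt : A ≠ ∞ := tsum_two_pow_rpow_ne_top (by linarith)
  set B := ∑' l : ℕ, mesh d p l * ((2 : ℝ≥0∞) ^ (l + 1)) ^ (θ * (d + 1)) with hB
  have hBt : B ≠ ∞ := by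
    have : ∀ l : ℕ, mesh d p l * ((2 : ℝ≥0∞) ^ (l + 1)) ^ (θ * (d + 1)) =
        (d : ℝ≥0∞) ^ p * 2 ^ (θ * (d + 1)) * ((2 : ℝ≥0∞) ^ l) ^ (θ * (d + 1) - p) := by
      intro l
      rw [mesh, ENNReal.mul_rpow_of_nonneg _ _ hp.le, pow_succ,
        ENNReal.mul_rpow_of_nonneg _ _ (by positivity), sub_eq_add_neg, two_pow_rpow_add,
        ENNReal.inv_rpow, ENNReal.rpow_neg]
      ring
    simp_rw [hB, this]
    rw [ENNReal.tsum_mul_left]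
    exact ENNReal.mul_ne_top (ENNReal.mul_ne_top
      (ENNReal.rpow_ne_top_of_nonneg hp.le (ENNReal.natCast_ne_top d))
      (ENNReal.rpow_ne_top_of_nonneg (by positivity) ENNReal.ofNat_ne_top))
      (tsum_two_pow_rpow_ne_top (by linarith))
  have h4 : (4 : ℝ≥0∞) ^ p ≠ ∞ := ENNReal.rpow_ne_top_of_nonneg hp.le ENNReal.ofNat_ne_top
  refine ⟨m + B * (C * A) + 4 ^ p * (C * A), by finiteness, fun T hT => ?_⟩
  have := M.isProbabilityMeasure_empiricalMeasure hT
  choose S hSm hS hSint using h T hT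
  set t := ENNReal.ofReal T ^ (-θ) with ht
  have ht0 : 0 < t := ENNReal.rpow_pos (by simpa using hT) ENNReal.ofReal_ne_top
  -- The depth `L` depends on `T`: the finest mesh must cost no more than the target rate. The
  -- constant stays uniform because the sum over levels is bounded by the full series `B`.
  obtain ⟨L, hL⟩ := exists_mesh_le d hp ht0
  have hshell : ∀ l, ∫⁻ ω, ∑' n, weight p n * S l n ω ∂(M.lawFrom μ) ≤
      C * t * ((2 : ℝ≥0∞) ^ l) ^ (θ * (d + 1)) * A := by
    intro l
    rw [lintegral_tsum fun n => ((hSm l n).const_mul _).aemeasurable, hA, ← ENNReal.tsum_mul_left]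
    refine ENNReal.tsum_le_tsum fun n => ?_
    rw [lintegral_const_mul _ (hSm l n)]
    refine (mul_le_mul_right (hSint l n) _).trans (le_of_eq ?_)
    rw [weight, sub_eq_add_neg p, two_pow_rpow_add]
    ring
  have hsm : ∀ l, Measurable fun ω => ∑' n, weight p n * S l n ω := fun l =>
    .tsum fun n => (hSm l n).const_mul _
  have hwm : Measurable fun x : Space d => (2 * (1 + ‖x‖ₑ)) ^ p := by fun_prop
  calc ∫⁻ ω, transportCost p (M.empiricalMeasure T ω) μ ∂(M.lawFrom μ)
      ≤ ∫⁻ ω, (mesh d p L * ∫⁻ x, (2 * (1 + ‖x‖ₑ)) ^ p ∂(M.empiricalMeasure T ω) +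
          ∑ l ∈ Finset.range L, mesh d p l * ∑' n, weight p n * S (l + 1) n ω +
          4 ^ p * ∑' n, weight p n * S 0 n ω) ∂(M.lawFrom μ) := by
        refine lintegral_mono fun ω =>
          (transportCost_le_meanDiscrepancy hp.le (M.empiricalMeasure T ω) μ L).trans ?_
        gcongr <;> exact hS _ _ ω
    _ = mesh d p L * m +
          ∑ l ∈ Finset.range L, mesh d p l *
            ∫⁻ ω, ∑' n, weight p n * S (l + 1) n ω ∂(M.lawFrom μ) +
          4 ^ p * ∫⁻ ω, ∑' n, weight p n * S 0 n ω ∂(M.lawFrom μ) := by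
        rw [lintegral_add_right _ ((hsm 0).const_mul _),
          lintegral_add_left ((M.measurable_lintegral_empiricalMeasure T hwm).const_mul _),
          lintegral_const_mul _ (M.measurable_lintegral_empiricalMeasure T hwm),
          M.lintegral_lintegral_empiricalMeasure hμ hT hwm, lintegral_const_mul _ (hsm 0),
          lintegral_finsetSum _ fun l _ => (hsm (l + 1)).const_mul _]
        simp_rw [lintegral_const_mul _ (hsm _)]
        rfl
    _ ≤ t * m + ∑ l ∈ Finset.range L, mesh d p l *
            (C * t * ((2 : ℝ≥0∞) ^ (l + 1)) ^ (θ * (d + 1)) * A) +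
          4 ^ p * (C * t * ((2 : ℝ≥0∞) ^ 0) ^ (θ * (d + 1)) * A) := by
        gcongr with l
        · exact hshell (l + 1)
        · exact hshell 0
    _ = t * m + (∑ l ∈ Finset.range L, mesh d p l * ((2 : ℝ≥0∞) ^ (l + 1)) ^ (θ * (d + 1))) *
          (C * t * A) + 4 ^ p * (C * t * A) := by
        rw [pow_zero, ENNReal.one_rpow, mul_one, Finset.sum_mul]
        congr 2
        exact Finset.sum_congr rfl fun l _ => by ring
    _ ≤ t * m + B * (C * t * A) + 4 ^ p * (C * t * A) := by
        gcongr
        exact ENNReal.sum_le_tsum _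
    _ = _ := by ring

end MarkovProcess

/-! ### The exponent of the rate and the logarithmic factors. -/

/-- From `ζ ≥ q / (q - p)` and `ζ ≥ d / p` follow `ζ ≥ 1`, `q ≤ ζ (q - p)` and `d ≤ ζ p`. The
denominator `2ζp + 1` exceeds what the last two conditions require, so both hold strictly. -/
lemma rate_bounds {p q : ℝ} (hp : 0 < p) (hpq : p < q) (d : ℕ) :
    0 ≤ p / (2 * zeta p q d * p + 1) ∧ 2 * (p / (2 * zeta p q d * p + 1)) ≤ 1 ∧
      p < q * (1 - p / (2 * zeta p q d * p + 1)) ∧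
      p / (2 * zeta p q d * p + 1) * (d + 1) < p := by
  have h1 : q / (q - p) ≤ zeta p q d := le_max_left _ _
  have h2 : (d : ℝ) / p ≤ zeta p q d := le_max_right _ _
  set z := zeta p q d
  have hqp : 0 < q - p := by linarith
  rw [div_le_iff₀ hqp] at h1
  rw [div_le_iff₀ hp] at h2
  have hz1 : 1 ≤ z := by
    by_contra! hz
    nlinarith
  have hzp : 0 < z * p := by positivity
  have hD : 0 < 2 * z * p + 1 := by nlinarith
  refine ⟨by positivity, ?_, ?_, ?_⟩
  · rw [← mul_div_assoc, div_le_one hD]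
    nlinarith
  · have : q * (p / (2 * z * p + 1)) < q - p := by
      rw [← mul_div_assoc, div_lt_iff₀ hD]
      nlinarith [mul_le_mul_of_nonneg_right h1 hp.le]
    linarith
  · rw [div_mul_eq_mul_div, div_lt_iff₀ hD]
    have : (d : ℝ) + 1 < 2 * z * p + 1 := by nlinarith
    exact mul_lt_mul_of_pos_left this hp

lemma exists_le_ite_log_rpow (P : Prop) [Decidable P] {a : ℝ} (ha : P → 0 ≤ a) :
    ∃ c : ℝ, 0 < c ∧ ∀ T : ℝ, 2 ≤ T → c ≤ if P then Real.log T ^ a else 1 := by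
  have hlog : 0 < Real.log 2 := Real.log_pos one_lt_two
  by_cases h : P
  · refine ⟨Real.log 2 ^ a, by positivity, fun T hT => ?_⟩
    rw [if_pos h]
    exact Real.rpow_le_rpow hlog.le (Real.log_le_log two_pos hT) (ha h)
  · exact ⟨1, one_pos, fun T _ => by rw [if_neg h]⟩

end EmpiricalMarkov

end

theorem theorem1p1 {d : ℕ} {Ω : Type*} [MeasurableSpace Ω]
    (M : EmpiricalMarkov.MarkovProcess d Ω)
    (μ : Measure (EmpiricalMarkov.Space d)) (hμ : M.IsInvariant μ)
    (hcontr : M.IsExpContractive μ)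
    (p q : ℝ) (hp : 0 < p) (hq : max p 1 < q)
    (hmoment : ∫⁻ x, ‖x‖ₑ ^ q ∂μ < ∞) :
    ∃ C : ℝ, 0 < C ∧ ∀ T : ℝ, 2 ≤ T →
      ∫⁻ ω, EmpiricalMarkov.transportCost p (M.empiricalMeasure T ω) μ ∂(M.lawFrom μ) ≤
        ENNReal.ofReal
          (C * T ^ (-(p / (2 * EmpiricalMarkov.zeta p q d * p + 1))) *
            (if q = d * p / (d - p) then Real.log T ^ (2 * (d : ℝ) / (2 * d + 1)) else 1) *
            (if p = d then Real.log T ^ (2 * q / (2 * q + q / d - 1)) else 1)) := by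
  have hpq : p < q := (le_max_left p 1).trans_lt hq
  have hq1 : 1 < q := (le_max_right p 1).trans_lt hq
  obtain ⟨h0, h1, h2, h3⟩ := EmpiricalMarkov.rate_bounds hp hpq d
  obtain ⟨K, hK, h⟩ := M.exists_lintegral_transportCost_le hμ hcontr hp hpq.le hq1.le hmoment.ne
    h0 h1 h2 h3
  obtain ⟨c₁, hc₁, hL₁⟩ := EmpiricalMarkov.exists_le_ite_log_rpow (q = d * p / (d - p))
    (a := 2 * (d : ℝ) / (2 * d + 1)) (fun _ => by positivity)
  obtain ⟨c₂, hc₂, hL₂⟩ := EmpiricalMarkov.exists_le_ite_log_rpow (p = d)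
    (a := 2 * q / (2 * q + q / d - 1)) (fun hpd => by
      have : 0 ≤ q / d := by positivity
      exact div_nonneg (by linarith) (by linarith))
  -- Dividing by the lower bounds `c₁` and `c₂` absorbs the logarithmic factors; adding `1` keeps
  -- the constant positive.
  refine ⟨(K.toReal + 1) / (c₁ * c₂), by positivity, fun T hT => ?_⟩
  have hT0 : 0 < T := by linarith
  refine (h T hT0).trans ?_
  nth_rw 1 [← ENNReal.ofReal_toReal hK]
  rw [ENNReal.ofReal_rpow_of_pos hT0, ← ENNReal.ofReal_mul ENNReal.toReal_nonneg]
  refine ENNReal.ofReal_le_ofReal ?_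
  set r := T ^ (-(p / (2 * EmpiricalMarkov.zeta p q d * p + 1)))
  have hr : 0 < r := Real.rpow_pos_of_pos hT0 _
  calc K.toReal * r ≤ (K.toReal + 1) * r := by gcongr; linarith
    _ = (K.toReal + 1) / (c₁ * c₂) * r * c₁ * c₂ := by field_simp
    _ ≤ _ := by
        have hl₁ := hL₁ T hT
        have hl₂ := hL₂ T hT
        have : 0 ≤ (K.toReal + 1) / (c₁ * c₂) * r := by positivity
        exact mul_le_mul (mul_le_mul_of_nonneg_left hl₁ this) hl₂ hc₂.le
          (mul_nonneg this (hc₁.le.trans hl₁))
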